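/- Fix sorted (integer and array) program variables $X$ with primed copies $X'$ and integer Skolem constants $SK=\{sk_0,sk_1,\dots\}$, and work in first-order logic over linear integer arithmetic and arrays (standard integers, arrays as maps $\mathbb Z\to\mathbb Z$). Let $P=\langle \mathit{Init}(X),\mathit{Tr}(X,X'),\mathit{Bad}(X)\rangle$ be a safety problem whose three formulas are quantifier free and ground, with $\mathit{Bad}$ a monomial (conjunction of literals). **Procedures used.** - A satisfiability solver whose answers are correct ("sat" with a model, or "unsat") and which is guaranteed to answer on quantifier-free formulas; on formulas with quantifiers it may run forever. - A partial model based projection: for ground $\varphi$ and $M\models\varphi$, $\mathrm{pMbp}(U,\varphi,M)=(\psi,W)$ with $\psi$ a ground monomial, $W\subseteq U$, $\mathit{Const}(\psi)\subseteq \mathit{Const}(\varphi)\setminus(U\setminus W)$, $\psi\Rightarrow\exists (U\setminus W)\cdot\varphi$, $M\models\psi$, and for fixed $U,\varphi$ only finitely many results as $M$ ranges over the models of $\varphi$. In all projections that arise from $P$ (starting with $\mathit{Bad}$ and taking predecessors, as below), $W$ contains no array constants. - A partial interpolation: for ground $A$ and a ground monomial $B$ with $A\Rightarrow\neg B$, $\mathrm{pItp}(A,B)=(\varphi,U)$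 with $\varphi$ a ground clause, $U\subseteq \mathit{Const}(B)\setminus \mathit{Const}(A)$, $\mathit{Const}(\varphi)\subseteq(\mathit{Const}(A)\cap \mathit{Const}(B))\cup U$, $A\Rightarrow\forall U\cdot\varphi$ and $\varphi\Rightarrow\neg B$. - An abstraction function: for ground $\varphi$ in which the constants of $U$ that occur are integers, $\mathrm{abs}(U,\varphi)=(\psi,\sigma)$ where $\psi$ is $\varphi$ with the constants of $U$ replaced by pairwise distinct variables, $sk_i$ being replaced by variable $i$, and $\sigma$ maps these variables back. **Quic3_Main.** A proof obligation (POB) is a triple $\langle m,\sigma,i\rangle$; a frame $Q_i$ is a finite set of pairs $(\ell,\sigma)$ of a lemma and a substitution; $\mathit{qi}(Q)$ is the conjunction of all $\ell\sigma$, $(\ell,\sigma)\in Q$, and $\forall Q$ is the set of universal closures of its lemmas. Write $m'_{sk}$ for $m$ with program variables primed and each variable $i$ replaced by $sk_i$. Initially $N=0$, $Q_0=\{(\mathit{Init},\emptyset)\}$, and all other frames are empty. If $\mathit{Init}\wedge\mathit{Bad}$ is satisfiable, return Cex. Otherwise repeat: set $N\gets N+1$, $Q_N\gets\emptyset$, and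 perform the following two phases. *MakeSafe.* Start with the queue $\{\langle \mathit{Bad},\emptyset,N\rangle\}$. While it is non-empty, take a POB $\langle m,\xi,i\rangle$ of lowest level. If $i=0$, return Cex. Query the solver on $\mathit{qi}(Q_{i-1})\wedge\mathit{Tr}\wedge m'_{sk}$. If it returns a model $M$, add $\langle\psi,\sigma,i-1\rangle$ to the queue, where $(\varphi,U)=\mathrm{pMbp}(X'\cup SK,\mathit{Tr}\wedge m'_{sk},M)$ and $(\psi,\sigma)=\mathrm{abs}(U,\varphi)$. If it answers unsat, remove the POB, let $L'$ be the clause of $\mathrm{pItp}(\mathit{qi}(Q_{i-1})\wedge\mathit{Tr},m'_{sk})$ and $\ell$ the formula of $\mathrm{abs}(SK,L)$. Optionally replace $(\ell,\xi)$ by a generalization $(g,\sigma)$ from a finite list of candidates, with $g$ quantifier free, $g\sigma$ ground, $g\sigma\equiv\ell\xi$, $\mathit{FVars}(\ell)\subseteq\mathit{FVars}(g)$, and such that the solver finds $((\mathit{qi}(Q_{i-1})\wedge\mathit{Tr})\vee\mathit{Init}')\wedge\neg g'$ unsatisfiable. Add the resulting pair to all $Q_j$, $j\le i$. *Push.* For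 $i=0,\dots,N-1$, go through some finite list of pairs $(\varphi,\sigma)$; when some $(\varphi\vee\psi,\sigma)\in Q_i$ ($\psi$ possibly empty), $(\varphi,\sigma)\notin Q_{i+1}$, and the solver finds unsatisfiable both $\mathit{Init}\wedge\neg\varphi$ and the conjunction of $\mathit{qi}(Q_i)$, $\mathit{Tr}$, $\neg\varphi'$ and finitely many chosen instances of $\varphi$ and of the lemmas of $Q_i$, add $(\varphi,\sigma)$ to all $Q_j$, $j\le i+1$. Afterwards, if $\forall Q_i\subseteq\forall Q_{i+1}$ for some $i<N$, return Safe. **Lemma (progress).** For every such $P$, all procedures as above, every maximal run of Quic3_Main (whatever the models returned by the solver and the heuristic choices) and every $k\in\mathbb N$: after finitely many steps the run reaches $N=k$, or returns Safe, or finds a counterexample (it returns Cex, and $P$ has a counterexample, of length the current $N$). -/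

import Mathlib

namespace Quic3

universe u

/-! ## The logic: linear integer arithmetic and arrays -/

/-- The two sorts. Array indices and array data are integers. -/
inductive Srt : Type
  | int
  | arr

/-- Uninterpreted constants over a sorted family `X` of program variables: the program variables
(pre-state), their primed copies (post-state), and the integer Skolem constants `sk 0, sk 1, …`. -/
inductive Const (X : Srt → Type u) : Srt → Type u
  | cur {s : Srt} (x : X s) : Const X s
  | nxt {s : Srt} (x : X s) : Const X s
  | sk (i : ℕ) : Const X Srt.int

/-- A constant together with its sort. -/
abbrev AnyConst (X : Srt → Type u) : Type u := Σ s, Const X s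

/-- Terms. Variables are integer variables, named by natural numbers; multiplication is linear,
i.e. by a numeral. -/
inductive Term (X : Srt → Type u) : Srt → Type u
  | var (i : ℕ) : Term X Srt.int
  | con {s : Srt} (c : Const X s) : Term X s
  | num (n : ℤ) : Term X Srt.int
  | add (a b : Term X Srt.int) : Term X Srt.int
  | sub (a b : Term X Srt.int) : Term X Srt.int
  | mul (n : ℤ) (a : Term X Srt.int) : Term X Srt.int
  | sel (a : Term X Srt.arr) (i : Term X Srt.int) : Term X Srt.int
  | store (a : Term X Srt.arr) (i v : Term X Srt.int) : Term X Srt.arr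

/-- First-order formulas; quantification is over integer variables. -/
inductive Formula (X : Srt → Type u) : Type u
  | tru : Formula X
  | fls : Formula X
  | lt (a b : Term X Srt.int) : Formula X
  | le (a b : Term X Srt.int) : Formula X
  | eq {s : Srt} (a b : Term X s) : Formula X
  | not (φ : Formula X) : Formula X
  | and (φ ψ : Formula X) : Formula X
  | or (φ ψ : Formula X) : Formula X
  | all (i : ℕ) (φ : Formula X) : Formula X

/-- Values: integers, and arrays as total maps from integers to integers. -/
abbrev Val : Srt → Type
  | Srt.int => ℤ
  | Srt.arr => ℤ → ℤ

/-- A structure: an interpretation of all uninterpreted constants. The interpreted symbols have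
their standard meaning. -/
abbrev Struct (X : Srt → Type u) : Type u := ∀ s, Const X s → Val s

/-- Values of the free variables. -/
abbrev Env : Type := ℕ → ℤ

/-- The value of a term. -/
def Term.eval {X : Srt → Type u} (M : Struct X) (e : Env) : {s : Srt} → Term X s → Val s
  | _, .var i => e i
  | _, .con c => M _ c
  | _, .num n => n
  | _, .add a b => (a.eval M e + b.eval M e : ℤ)
  | _, .sub a b => (a.eval M e - b.eval M e : ℤ)
  | _, .mul n a => (n * a.eval M e : ℤ)
  | _, .sel a i => (a.eval M e : ℤ → ℤ) (i.eval M e)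
  | _, .store a i v => Function.update (a.eval M e : ℤ → ℤ) (i.eval M e) (v.eval M e)

/-- Truth of a formula in a structure, under an assignment of the free variables. -/
def Formula.Sat {X : Srt → Type u} (M : Struct X) : Env → Formula X → Prop
  | _, .tru => True
  | _, .fls => False
  | e, .lt a b => (a.eval M e : ℤ) < b.eval M e
  | e, .le a b => (a.eval M e : ℤ) ≤ b.eval M e
  | e, .eq a b => a.eval M e = b.eval M e
  | e, .not φ => ¬ φ.Sat M e
  | e, .and φ ψ => φ.Sat M e ∧ ψ.Sat M e
  | e, .or φ ψ => φ.Sat M e ∨ ψ.Sat M e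
  | e, .all i φ => ∀ n : ℤ, φ.Sat M (Function.update e i n)

/-- `M ⊨ φ` (under every assignment; the assignment is irrelevant when `φ` is ground). -/
def Models {X : Srt → Type u} (M : Struct X) (φ : Formula X) : Prop := ∀ e, φ.Sat M e

/-- Satisfiability. Free variables are read existentially. -/
def Satisfiable {X : Srt → Type u} (φ : Formula X) : Prop := ∃ M e, φ.Sat M e

/-- `φ ⇒ ψ`: validity of the implication. -/
def Entails {X : Srt → Type u} (φ ψ : Formula X) : Prop := ∀ M e, φ.Sat M e → ψ.Sat M e

/-- `φ ≡ ψ`. -/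
def Equivalent {X : Srt → Type u} (φ ψ : Formula X) : Prop := ∀ M e, φ.Sat M e ↔ ψ.Sat M e

/-- `M` and `M'` may differ only on the constants in `U`. -/
def AgreeOff {X : Srt → Type u} (U : Set (AnyConst X)) (M M' : Struct X) : Prop :=
  ∀ s (c : Const X s), (⟨s, c⟩ : AnyConst X) ∉ U → M s c = M' s c

def Term.fvars {X : Srt → Type u} : {s : Srt} → Term X s → Finset ℕ
  | _, .var i => {i}
  | _, .con _ => ∅
  | _, .num _ => ∅
  | _, .add a b => a.fvars ∪ b.fvars
  | _, .sub a b => a.fvars ∪ b.fvars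
  | _, .mul _ a => a.fvars
  | _, .sel a i => a.fvars ∪ i.fvars
  | _, .store a i v => a.fvars ∪ (i.fvars ∪ v.fvars)

def Formula.fvars {X : Srt → Type u} : Formula X → Finset ℕ
  | .tru => ∅
  | .fls => ∅
  | .lt a b => a.fvars ∪ b.fvars
  | .le a b => a.fvars ∪ b.fvars
  | .eq a b => a.fvars ∪ b.fvars
  | .not φ => φ.fvars
  | .and φ ψ => φ.fvars ∪ ψ.fvars
  | .or φ ψ => φ.fvars ∪ ψ.fvars
  | .all i φ => φ.fvars.erase i

/-- The uninterpreted constants of a term. -/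
def Term.consts {X : Srt → Type u} : {s : Srt} → Term X s → Set (AnyConst X)
  | _, .var _ => ∅
  | s, .con c => {⟨s, c⟩}
  | _, .num _ => ∅
  | _, .add a b => a.consts ∪ b.consts
  | _, .sub a b => a.consts ∪ b.consts
  | _, .mul _ a => a.consts
  | _, .sel a i => a.consts ∪ i.consts
  | _, .store a i v => a.consts ∪ (i.consts ∪ v.consts)

/-- The uninterpreted constants of a formula. -/
def Formula.consts {X : Srt → Type u} : Formula X → Set (AnyConst X)
  | .tru => ∅
  | .fls => ∅
  | .lt a b => a.consts ∪ b.consts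
  | .le a b => a.consts ∪ b.consts
  | .eq a b => a.consts ∪ b.consts
  | .not φ => φ.consts
  | .and φ ψ => φ.consts ∪ ψ.consts
  | .or φ ψ => φ.consts ∪ ψ.consts
  | .all _ φ => φ.consts

/-- Quantifier-free formulas. -/
def Formula.QF {X : Srt → Type u} : Formula X → Prop
  | .not φ => φ.QF
  | .and φ ψ => φ.QF ∧ ψ.QF
  | .or φ ψ => φ.QF ∧ ψ.QF
  | .all _ _ => False
  | _ => True

/-- Ground formulas: quantifier free, without variables. -/
def Formula.Ground {X : Srt → Type u} (φ : Formula X) : Prop := φ.QF ∧ φ.fvars = ∅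

def Formula.IsAtom {X : Srt → Type u} : Formula X → Prop
  | .tru => True
  | .fls => True
  | .lt _ _ => True
  | .le _ _ => True
  | .eq _ _ => True
  | _ => False

def Formula.IsLit {X : Srt → Type u} : Formula X → Prop
  | .not φ => φ.IsAtom
  | φ => φ.IsAtom

/-- Conjunctions of literals (monomials, cubes). -/
def Formula.IsMonomial {X : Srt → Type u} : Formula X → Prop
  | .and φ ψ => φ.IsMonomial ∧ ψ.IsMonomial
  | φ => φ.IsLit

/-- Disjunctions of literals. -/
def Formula.IsClause {X : Srt → Type u} : Formula X → Prop
  | .or φ ψ => φ.IsClause ∧ ψ.IsClause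
  | φ => φ.IsLit

/-- The top-level disjuncts of a formula. -/
def Formula.disjuncts {X : Srt → Type u} : Formula X → List (Formula X)
  | .fls => []
  | .or φ ψ => φ.disjuncts ++ ψ.disjuncts
  | φ => [φ]

/-- `χ` is `φ ∨ ψ` for some possibly empty `ψ`, up to the order, the bracketing and the repetition
of disjuncts. -/
def Formula.SubDisj {X : Srt → Type u} (φ χ : Formula X) : Prop := φ.disjuncts ⊆ χ.disjuncts

/-- Finite conjunctions. -/
def Formula.conj {X : Srt → Type u} (l : List (Formula X)) : Formula X :=
  l.foldr Formula.and Formula.tru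

/-- `∀ φ`: the universal closure. -/
def Formula.closure {X : Srt → Type u} (φ : Formula X) : Formula X :=
  (φ.fvars.sort (· ≤ ·)).foldr Formula.all φ

/-- Substitutions: partial maps from (integer) variables to terms. -/
abbrev Subst (X : Srt → Type u) : Type u := ℕ → Option (Term X Srt.int)

def Subst.empty {X : Srt → Type u} : Subst X := fun _ => none

def Subst.dom {X : Srt → Type u} (σ : Subst X) : Set ℕ := {i | (σ i).isSome}

/-- All terms in the range are without variables. -/
def Subst.IsGround {X : Srt → Type u} (σ : Subst X) : Prop := ∀ i t, σ i = some t → t.fvars = ∅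

def Term.subst {X : Srt → Type u} (σ : Subst X) : {s : Srt} → Term X s → Term X s
  | _, .var i => (σ i).getD (.var i)
  | _, .con c => .con c
  | _, .num n => .num n
  | _, .add a b => .add (a.subst σ) (b.subst σ)
  | _, .sub a b => .sub (a.subst σ) (b.subst σ)
  | _, .mul n a => .mul n (a.subst σ)
  | _, .sel a i => .sel (a.subst σ) (i.subst σ)
  | _, .store a i v => .store (a.subst σ) (i.subst σ) (v.subst σ)

/-- Applying a substitution. It is only ever applied to quantifier-free formulas, so that no
variable can be captured. -/
def Formula.subst {X : Srt → Type u} : Subst X → Formula X → Formula X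
  | _, .tru => .tru
  | _, .fls => .fls
  | σ, .lt a b => .lt (a.subst σ) (b.subst σ)
  | σ, .le a b => .le (a.subst σ) (b.subst σ)
  | σ, .eq a b => .eq (a.subst σ) (b.subst σ)
  | σ, .not φ => .not (φ.subst σ)
  | σ, .and φ ψ => .and (φ.subst σ) (ψ.subst σ)
  | σ, .or φ ψ => .or (φ.subst σ) (ψ.subst σ)
  | σ, .all i φ => .all i (φ.subst (Function.update σ i none))

/-- The Skolem substitution, mapping variable `i` to the Skolem constant `sk i`. -/
def skSubst {X : Srt → Type u} : Subst X := fun i => some (.con (.sk i))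

/-- `φ_sk`. -/
def Formula.skolem {X : Srt → Type u} (φ : Formula X) : Formula X := φ.subst skSubst

/-- Renaming of constants. -/
def Term.mapC {X : Srt → Type u} (f : ∀ s, Const X s → Const X s) : {s : Srt} → Term X s → Term X s
  | _, .var i => .var i
  | _, .con c => .con (f _ c)
  | _, .num n => .num n
  | _, .add a b => .add (a.mapC f) (b.mapC f)
  | _, .sub a b => .sub (a.mapC f) (b.mapC f)
  | _, .mul n a => .mul n (a.mapC f)
  | _, .sel a i => .sel (a.mapC f) (i.mapC f)
  | _, .store a i v => .store (a.mapC f) (i.mapC f) (v.mapC f)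

def Formula.mapC {X : Srt → Type u} (f : ∀ s, Const X s → Const X s) : Formula X → Formula X
  | .tru => .tru
  | .fls => .fls
  | .lt a b => .lt (a.mapC f) (b.mapC f)
  | .le a b => .le (a.mapC f) (b.mapC f)
  | .eq a b => .eq (a.mapC f) (b.mapC f)
  | .not φ => .not (φ.mapC f)
  | .and φ ψ => .and (φ.mapC f) (ψ.mapC f)
  | .or φ ψ => .or (φ.mapC f) (ψ.mapC f)
  | .all i φ => .all i (φ.mapC f)

def Const.prime {X : Srt → Type u} : ∀ s, Const X s → Const X s
  | _, .cur x => .nxt x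
  | _, .nxt x => .nxt x
  | _, .sk i => .sk i

def Const.unprime {X : Srt → Type u} : ∀ s, Const X s → Const X s
  | _, .cur x => .cur x
  | _, .nxt x => .cur x
  | _, .sk i => .sk i

/-- The primed formula: every program variable is replaced by its post-state copy. -/
def Formula.prime {X : Srt → Type u} (φ : Formula X) : Formula X := φ.mapC Const.prime

/-- For a formula without pre-state constants, the formula whose primed version it is. -/
def Formula.unprime {X : Srt → Type u} (φ : Formula X) : Formula X := φ.mapC Const.unprime

/-- The program variables. -/
def curSet (X : Srt → Type u) : Set (AnyConst X) := {c | ∃ s, ∃ x : X s, c = ⟨s, .cur x⟩}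

/-- The primed program variables. -/
def nxtSet (X : Srt → Type u) : Set (AnyConst X) := {c | ∃ s, ∃ x : X s, c = ⟨s, .nxt x⟩}

/-- The Skolem constants. -/
def skSet (X : Srt → Type u) : Set (AnyConst X) := {c | ∃ i : ℕ, c = ⟨Srt.int, .sk i⟩}

/-! ## Safety problems -/

structure SafetyProblem (X : Srt → Type u) where
  init : Formula X
  tr : Formula X
  bad : Formula X
  init_ground : init.Ground
  tr_ground : tr.Ground
  bad_ground : bad.Ground
  init_consts : init.consts ⊆ curSet X
  tr_consts : tr.consts ⊆ curSet X ∪ nxtSet X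
  bad_consts : bad.consts ⊆ curSet X

/-- States: interpretations of the program variables. -/
abbrev State (X : Srt → Type u) : Type u := ∀ s, X s → Val s

/-- The structure with pre-state `a` and post-state `b` (Skolem constants are irrelevant here). -/
def State.pair {X : Srt → Type u} (a b : State X) : Struct X
  | _, .cur x => a _ x
  | _, .nxt x => b _ x
  | _, .sk _ => (0 : ℤ)

/-- There is a counterexample of length `k`: an assignment to `k + 1` copies of the program
variables that satisfies `Init(X₀) ∧ Tr(X₀,X₁) ∧ … ∧ Tr(X_{k-1},X_k) ∧ Bad(X_k)`. -/
def SafetyProblem.HasCounterexample {X : Srt → Type u} (P : SafetyProblem X) (k : ℕ) : Prop :=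
  ∃ a : ℕ → State X,
    Models (State.pair (a 0) (a 0)) P.init ∧
    (∀ i < k, Models (State.pair (a i) (a (i + 1))) P.tr) ∧
    Models (State.pair (a k) (a k)) P.bad

/-! ## The procedures that the algorithm calls -/

/-- What may happen when the solver is called. -/
inductive Outcome (X : Srt → Type u) : Type u
  | sat (M : Struct X)
  | unsat
  | diverges

/-- A (not necessarily deterministic) satisfiability solver for first-order formulas. Its answers
are correct; it is guaranteed to answer on quantifier-free formulas, and may run forever on
formulas with quantifiers. -/
structure Solver (X : Srt → Type u) where
  /-- the possible outcomes of a call -/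
  call : Formula X → Outcome X → Prop
  exists_outcome : ∀ φ, ∃ o, call φ o
  sat_sound : ∀ φ M, call φ (.sat M) → ∃ e, φ.Sat M e
  unsat_sound : ∀ φ, call φ .unsat → ¬ Satisfiable φ
  terminates : ∀ φ, φ.QF → ¬ call φ .diverges

/-- An abstraction function: `abs U φ = (ψ, σ)` where `ψ` is `φ` with the constants in `U` replaced
by variables, and `σ` maps these variables back to the constants. Skolem constants `sk i` are
replaced by variable `i`. All variables being integers, only constants of sort `int` can be
replaced. -/
structure Abstraction (X : Srt → Type u) where
  abs : Set (AnyConst X) → Formula X → Formula X × Subst X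
  spec : ∀ (U : Set (AnyConst X)) (φ : Formula X), φ.Ground →
    (∀ c ∈ φ.consts ∩ U, c.1 = Srt.int) →
    (abs U φ).1.subst (abs U φ).2 = φ ∧
    (abs U φ).2.dom = {i | i ∈ (abs U φ).1.fvars ∧ i ∉ φ.fvars} ∧
    Disjoint U (abs U φ).1.consts ∧
    (∀ i t, (abs U φ).2 i = some t →
      ∃ c : Const X Srt.int, (⟨Srt.int, c⟩ : AnyConst X) ∈ U ∧ t = .con c) ∧
    (∀ i j t, (abs U φ).2 i = some t → (abs U φ).2 j = some t → i = j) ∧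
    (∀ i, (⟨Srt.int, .sk i⟩ : AnyConst X) ∈ U ∩ φ.consts →
      (abs U φ).2 i = some (.con (.sk i)))

/-- (Partial) model based projection: `mbp U φ M = (ψ, W)`, where `W` are the constants of `U` that
are not eliminated. -/
structure MBP (X : Srt → Type u) where
  mbp : Set (AnyConst X) → Formula X → Struct X → Formula X × Set (AnyConst X)
  ground_monomial : ∀ U φ M, φ.Ground → Models M φ →
    (mbp U φ M).1.IsMonomial ∧ (mbp U φ M).1.Ground
  consts_sub : ∀ U φ M, φ.Ground → Models M φ →
    (mbp U φ M).2 ⊆ U ∧ (mbp U φ M).1.consts ⊆ φ.consts \ (U \ (mbp U φ M).2)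
  /-- `ψ ⇒ ∃ U \ W · φ` -/
  under : ∀ U φ M, φ.Ground → Models M φ →
    ∀ M₁, Models M₁ (mbp U φ M).1 →
      ∃ M₂, AgreeOff (U \ (mbp U φ M).2) M₁ M₂ ∧ Models M₂ φ
  models : ∀ U φ M, φ.Ground → Models M φ → Models M (mbp U φ M).1
  finite_range : ∀ U φ, φ.Ground → {r | ∃ M, Models M φ ∧ r = mbp U φ M}.Finite

/-- (Partial) interpolation: `itp A B = (φ, U)`. -/
structure Interpolation (X : Srt → Type u) where
  itp : Formula X → Formula X → Formula X × Set (AnyConst X)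
  ground_clause : ∀ A B, A.Ground → B.Ground → B.IsMonomial → Entails A B.not →
    (itp A B).1.IsClause ∧ (itp A B).1.Ground
  consts_sub : ∀ A B, A.Ground → B.Ground → B.IsMonomial → Entails A B.not →
    (itp A B).2 ⊆ B.consts \ A.consts ∧
    (itp A B).1.consts ⊆ (A.consts ∩ B.consts) ∪ (itp A B).2
  /-- `A ⇒ ∀ U · φ` -/
  left : ∀ A B, A.Ground → B.Ground → B.IsMonomial → Entails A B.not →
    ∀ M M', Models M A → AgreeOff (itp A B).2 M M' → Models M' (itp A B).1
  right : ∀ A B, A.Ground → B.Ground → B.IsMonomial → Entails A B.not →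
    Entails (itp A B).1 B.not

/-! ## Proof obligations and the quantified trace -/

/-- A proof obligation `⟨m, σ, i⟩`. -/
structure POB (X : Srt → Type u) where
  body : Formula X
  inst : Subst X
  level : ℕ

/-- An element `(ℓ, σ)` of a frame: the lemma `∀ ℓ` and its ground instance `ℓσ`. -/
structure FrameLemma (X : Srt → Type u) where
  body : Formula X
  inst : Subst X

/-- A frame. It is a finite set, listed in some order. -/
abbrev Frame (X : Srt → Type u) : Type u := List (FrameLemma X)

/-- A trace `Q₀, Q₁, …`. -/
abbrev Trace (X : Srt → Type u) : Type u := ℕ → Frame X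

/-- `qi(Q)`: the conjunction of the instances in a frame. -/
def qi {X : Srt → Type u} (Q : Frame X) : Formula X :=
  Formula.conj (Q.map fun l => l.body.subst l.inst)

/-- `∀Q`: the set of (closed) lemmas of a frame. -/
def allQ {X : Srt → Type u} (Q : Frame X) : Set (Formula X) :=
  {φ | ∃ l ∈ Q, φ = l.body.closure}

/-- Adding a lemma to all frames `Q_j` with `j ≤ i`. -/
def Trace.add {X : Srt → Type u} (Q : Trace X) (i : ℕ) (l : FrameLemma X) : Trace X :=
  fun j => if j ≤ i then l :: Q j else Q j

/-- `𝓕(A) = (A(X) ∧ Tr(X,X')) ∨ Init(X')`. -/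
def SafetyProblem.fwd {X : Srt → Type u} (P : SafetyProblem X) (A : Formula X) : Formula X :=
  (A.and P.tr).or P.init.prime

/-- `Tr ∧ m'_sk`. -/
def SafetyProblem.preFormula {X : Srt → Type u} (P : SafetyProblem X) (m : Formula X) : Formula X :=
  P.tr.and m.prime.skolem

/-- The result of model based projection in the **Predecessor** rule. -/
def SafetyProblem.project {X : Srt → Type u} (P : SafetyProblem X) (B : MBP X)
    (m : Formula X) (M : Struct X) : Formula X × Set (AnyConst X) :=
  B.mbp (nxtSet X ∪ skSet X) (P.preFormula m) M

/-- The predecessor at level `i` of a proof obligation with formula `m`, from the model `M`. -/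
def SafetyProblem.predecessor {X : Srt → Type u} (P : SafetyProblem X) (B : MBP X)
    (A : Abstraction X) (m : Formula X) (M : Struct X) (i : ℕ) : POB X :=
  ⟨(A.abs (P.project B m M).2 (P.project B m M).1).1,
   (A.abs (P.project B m M).2 (P.project B m M).1).2, i⟩

/-- The formulas of the proof obligations that arise from `Bad` by taking predecessors. -/
inductive SafetyProblem.Arises {X : Srt → Type u} (P : SafetyProblem X) (B : MBP X)
    (A : Abstraction X) : Formula X → Prop
  | bad : P.Arises B A P.bad
  | pred (m : Formula X) (M : Struct X) (i : ℕ) :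
      P.Arises B A m → Models M (P.preFormula m) →
      P.Arises B A (P.predecessor B A m M i).body

/-- The projection eliminates all constants of sort array, in the projections that can arise in
the given safety problem. -/
def SafetyProblem.EliminatesArrays {X : Srt → Type u} (P : SafetyProblem X) (B : MBP X)
    (A : Abstraction X) : Prop :=
  ∀ m M, P.Arises B A m → Models M (P.preFormula m) →
    ∀ c ∈ (P.project B m M).2, c.1 = Srt.int

/-- The lemma `ℓ` that blocks the formula `m` over a frame `Q` (before quantified generalization):
`L' = Itp(qi(Q) ∧ Tr, m'_sk)` and `(ℓ, _) = abs(SK, L)`. -/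
def SafetyProblem.blockingLemma {X : Srt → Type u} (P : SafetyProblem X) (I : Interpolation X)
    (A : Abstraction X) (Q : Frame X) (m : Formula X) : Formula X :=
  (A.abs (skSet X) (I.itp ((qi Q).and P.tr) m.prime.skolem).1.unprime).1

/-- `c = (g, σ)` is a candidate for the quantified generalization of `(ℓ, ξ)`: `gσ ≡ ℓξ` and
`FVars(ℓ) ⊆ FVars(g)` (with `g` quantifier free over the program variables and variables, and `gσ`
ground). -/
def QGenCandidate {X : Srt → Type u} (ℓ : Formula X) (ξ : Subst X) (c : FrameLemma X) : Prop :=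
  c.body.QF ∧ c.body.consts ⊆ curSet X ∧ (∀ i ∈ c.body.fvars, i ∈ c.inst.dom) ∧
  c.inst.IsGround ∧ Equivalent (c.body.subst c.inst) (ℓ.subst ξ) ∧ ℓ.fvars ⊆ c.body.fvars

/-- `c = (φ, σ)` may be considered for pushing from frame `Q` to frame `Q'`: some `(φ ∨ ψ, σ)` is in
`Q`, and `(φ, σ)` is not in `Q'`. -/
def Pushable {X : Srt → Type u} (Q Q' : Frame X) (c : FrameLemma X) : Prop :=
  (∃ l ∈ Q, l.inst = c.inst ∧ c.body.SubDisj l.body) ∧ c ∉ Q'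

/-- The query deciding whether `φ` is pushed from frame `Q`: the quantified formulas `∀φ` and `∀Q`
are replaced by their instances under the finitely many substitutions `ρs`. The variables of `¬φ'`
are free, hence implicitly Skolemized. -/
def SafetyProblem.pushQuery {X : Srt → Type u} (P : SafetyProblem X) (Q : Frame X)
    (ρs : List (Subst X)) (φ : Formula X) : Formula X :=
  Formula.conj
    [Formula.conj (ρs.map fun ρ => φ.subst ρ),
     Formula.conj (Q.map fun l => Formula.conj (ρs.map fun ρ => l.body.subst ρ)),
     qi Q, P.tr, φ.prime.not]

/-! ## `Quic3_Main` -/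

inductive Result : Type
  | safe
  | cex

/-- Control locations of the procedure, with the local data. -/
inductive Control (X : Srt → Type u) : Type u
  /-- before the test of `Init ∧ Bad` -/
  | start
  /-- head of the main loop -/
  | loop
  /-- head of the loop of `Quic3_MakeSafe`, with the queue of proof obligations -/
  | makeSafe (queue : Set (POB X))
  /-- the proof obligation `p` was just removed, `(ℓ, p.inst)` is the lemma that blocks it;
  `cands` are the generalizations that remain to be tried -/
  | qgen (queue : Set (POB X)) (p : POB X) (ℓ : Formula X) (cands : List (FrameLemma X))
  /-- `Quic3_Push`, about to push from frame `i` -/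
  | push (i : ℕ)
  /-- pushing from frame `i`, with the instantiations used and the candidates that remain -/
  | pushing (i : ℕ) (ρs : List (Subst X)) (cands : List (FrameLemma X))
  /-- the procedure has returned -/
  | ret (r : Result)
  /-- waiting for a call to the solver that never returns -/
  | hang

structure Config (X : Srt → Type u) where
  /-- the level -/
  N : ℕ
  trace : Trace X
  ctrl : Control X

/-- `N ← 0; Q₀ = {(Init, ∅)}`. -/
def SafetyProblem.initial {X : Srt → Type u} (P : SafetyProblem X) : Config X :=
  ⟨0, fun i => if i = 0 then [⟨P.init, Subst.empty⟩] else [], .start⟩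

/-- `p` may be returned by `Top`: the queue is ordered by level, lowest level first. -/
def IsTop {X : Srt → Type u} (queue : Set (POB X)) (p : POB X) : Prop :=
  p ∈ queue ∧ ∀ q ∈ queue, p.level ≤ q.level

/-- The condition of the **Safe** rule. -/
def SafeCond {X : Srt → Type u} (N : ℕ) (Q : Trace X) : Prop :=
  ∃ i < N, allQ (Q i) ⊆ allQ (Q (i + 1))

/-- The steps of `Quic3_Main`. Heuristic choices (which generalizations of a lemma to try, which
lemmas to push, and which finite set of instantiations to use) are arbitrary, and so is the model
that the solver returns. -/
inductive Step {X : Srt → Type u} (P : SafetyProblem X) (S : Solver X) (B : MBP X)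
    (I : Interpolation X) (A : Abstraction X) : Config X → Config X → Prop
  -- main procedure
  | start_sat (N Q M) : S.call (P.init.and P.bad) (.sat M) →
      Step P S B I A ⟨N, Q, .start⟩ ⟨N, Q, .ret .cex⟩
  | start_unsat (N Q) : S.call (P.init.and P.bad) .unsat →
      Step P S B I A ⟨N, Q, .start⟩ ⟨N, Q, .loop⟩
  | start_hang (N Q) : S.call (P.init.and P.bad) .diverges →
      Step P S B I A ⟨N, Q, .start⟩ ⟨N, Q, .hang⟩
  | unfold (N Q) :
      Step P S B I A ⟨N, Q, .loop⟩
        ⟨N + 1, Function.update Q (N + 1) [],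
          .makeSafe {⟨P.bad, Subst.empty, N + 1⟩}⟩
  -- blocking phase
  | blocked (N Q) : Step P S B I A ⟨N, Q, .makeSafe ∅⟩ ⟨N, Q, .push 0⟩
  | cex (N Q queue p) : IsTop queue p → p.level = 0 →
      Step P S B I A ⟨N, Q, .makeSafe queue⟩ ⟨N, Q, .ret .cex⟩
  | predecessor (N Q queue p i M) : IsTop queue p → p.level = i + 1 →
      S.call ((qi (Q i)).and (P.preFormula p.body)) (.sat M) →
      Step P S B I A ⟨N, Q, .makeSafe queue⟩
        ⟨N, Q, .makeSafe (insert (P.predecessor B A p.body M i) queue)⟩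
  | block (N Q queue p i cands) : IsTop queue p → p.level = i + 1 →
      S.call ((qi (Q i)).and (P.preFormula p.body)) .unsat →
      (∀ c ∈ cands, QGenCandidate (P.blockingLemma I A (Q i) p.body) p.inst c) →
      Step P S B I A ⟨N, Q, .makeSafe queue⟩
        ⟨N, Q, .qgen (queue \ {p}) p (P.blockingLemma I A (Q i) p.body) cands⟩
  | block_hang (N Q queue p i) : IsTop queue p → p.level = i + 1 →
      S.call ((qi (Q i)).and (P.preFormula p.body)) .diverges →
      Step P S B I A ⟨N, Q, .makeSafe queue⟩ ⟨N, Q, .hang⟩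
  -- quantified generalization and addition of the new lemma
  | qgen_none (N Q queue p ℓ) :
      Step P S B I A ⟨N, Q, .qgen queue p ℓ []⟩
        ⟨N, Trace.add Q p.level ⟨ℓ, p.inst⟩, .makeSafe queue⟩
  | qgen_ok (N Q queue p ℓ c cs) :
      S.call ((P.fwd (qi (Q (p.level - 1)))).and c.body.prime.not) .unsat →
      Step P S B I A ⟨N, Q, .qgen queue p ℓ (c :: cs)⟩
        ⟨N, Trace.add Q p.level c, .makeSafe queue⟩
  | qgen_fail (N Q queue p ℓ c cs M) :
      S.call ((P.fwd (qi (Q (p.level - 1)))).and c.body.prime.not) (.sat M) →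
      Step P S B I A ⟨N, Q, .qgen queue p ℓ (c :: cs)⟩ ⟨N, Q, .qgen queue p ℓ cs⟩
  | qgen_hang (N Q queue p ℓ c cs) :
      S.call ((P.fwd (qi (Q (p.level - 1)))).and c.body.prime.not) .diverges →
      Step P S B I A ⟨N, Q, .qgen queue p ℓ (c :: cs)⟩ ⟨N, Q, .hang⟩
  -- pushing phase
  | push_frame (N Q i ρs cands) : i < N →
      Step P S B I A ⟨N, Q, .push i⟩ ⟨N, Q, .pushing i ρs cands⟩
  | push_safe (N Q i) : N ≤ i → SafeCond N Q →
      Step P S B I A ⟨N, Q, .push i⟩ ⟨N, Q, .ret .safe⟩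
  | push_done (N Q i) : N ≤ i → ¬ SafeCond N Q →
      Step P S B I A ⟨N, Q, .push i⟩ ⟨N, Q, .loop⟩
  | pushing_nil (N Q i ρs) :
      Step P S B I A ⟨N, Q, .pushing i ρs []⟩ ⟨N, Q, .push (i + 1)⟩
  | pushing_skip (N Q i ρs c cs) : ¬ Pushable (Q i) (Q (i + 1)) c →
      Step P S B I A ⟨N, Q, .pushing i ρs (c :: cs)⟩ ⟨N, Q, .pushing i ρs cs⟩
  | pushing_init_fail (N Q i ρs c cs M) : Pushable (Q i) (Q (i + 1)) c →
      S.call (P.init.and c.body.not) (.sat M) →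
      Step P S B I A ⟨N, Q, .pushing i ρs (c :: cs)⟩ ⟨N, Q, .pushing i ρs cs⟩
  | pushing_init_hang (N Q i ρs c cs) : Pushable (Q i) (Q (i + 1)) c →
      S.call (P.init.and c.body.not) .diverges →
      Step P S B I A ⟨N, Q, .pushing i ρs (c :: cs)⟩ ⟨N, Q, .hang⟩
  | pushing_fail (N Q i ρs c cs M) : Pushable (Q i) (Q (i + 1)) c →
      S.call (P.init.and c.body.not) .unsat →
      S.call (P.pushQuery (Q i) ρs c.body) (.sat M) →
      Step P S B I A ⟨N, Q, .pushing i ρs (c :: cs)⟩ ⟨N, Q, .pushing i ρs cs⟩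
  | pushing_hang (N Q i ρs c cs) : Pushable (Q i) (Q (i + 1)) c →
      S.call (P.init.and c.body.not) .unsat →
      S.call (P.pushQuery (Q i) ρs c.body) .diverges →
      Step P S B I A ⟨N, Q, .pushing i ρs (c :: cs)⟩ ⟨N, Q, .hang⟩
  | pushing_ok (N Q i ρs c cs) : Pushable (Q i) (Q (i + 1)) c →
      S.call (P.init.and c.body.not) .unsat →
      S.call (P.pushQuery (Q i) ρs c.body) .unsat →
      Step P S B I A ⟨N, Q, .pushing i ρs (c :: cs)⟩
        ⟨N, Trace.add Q (i + 1) c, .pushing i ρs cs⟩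
  -- a call that does not return
  | hang (N Q) : Step P S B I A ⟨N, Q, .hang⟩ ⟨N, Q, .hang⟩

/-- A maximal run of `Quic3_Main`, as an infinite sequence: it goes on as long as a step is
possible, and its last configuration (if any) is repeated forever. -/
def IsRun {X : Srt → Type u} (P : SafetyProblem X) (S : Solver X) (B : MBP X)
    (I : Interpolation X) (A : Abstraction X) (run : ℕ → Config X) : Prop :=
  run 0 = P.initial ∧
  ∀ n, Step P S B I A (run n) (run (n + 1)) ∨
    ((¬ ∃ c, Step P S B I A (run n) c) ∧ run (n + 1) = run n)

end Quic3

/-!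
While the level is `N`, every proof obligation is obtained from `Bad` at level `N` by at most `N`
predecessor steps. A projection has finitely many results, so only finitely many obligations can
ever be raised at that level. Give an obligation weight `1` while it is queued, and otherwise weight
`0` or `2` according to whether its frame excludes its ground instance. The model from which a
predecessor is projected satisfies both the frame and the instance of the predecessor, which
therefore was unqueued and not excluded: queueing it lowers its weight from `2` to `1`. Blocking an
obligation adds a lemma that excludes its instance, and lowers its weight from `1` to `0`. Since
frames only grow, no weight ever increases, so the blocking phase ends. Frame instances are ground,
so all queries are quantifier free and the solver answers them.

A model of a predecessor has a transition to a model of its parent, and an obligation that reaches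
level `0` is satisfied by an initial state, because the solver's model satisfies
`qi(Q₀) ⇒ Init`. This gives a counterexample of length `N`.
-/

namespace Quic3

variable {X : Srt → Type*}

/-! ### Syntax and semantics -/

theorem Term.eval_congr {M M' : Struct X} {e e' : Env} {s : Srt} (t : Term X s)
    (hM : ∀ s (c : Const X s), (⟨s, c⟩ : AnyConst X) ∈ t.consts → M s c = M' s c)
    (he : ∀ i ∈ t.fvars, e i = e' i) : t.eval M e = t.eval M' e' := by
  induction t with
  | var i => exact he i (by simp only [fvars, Finset.mem_singleton])
  | con c => exact hM _ c (by simp only [consts, Set.mem_singleton_iff])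
  | num n => rfl
  | _ =>
    simp only [consts, fvars, Set.mem_union, Finset.mem_union] at hM he
    simp_all [eval]

theorem Formula.sat_congr {M M' : Struct X} {e e' : Env} (φ : Formula X)
    (hM : ∀ s (c : Const X s), (⟨s, c⟩ : AnyConst X) ∈ φ.consts → M s c = M' s c)
    (he : ∀ i ∈ φ.fvars, e i = e' i) : φ.Sat M e ↔ φ.Sat M' e' := by
  induction φ generalizing e e' with
  | tru | fls => rfl
  | lt a b | le a b | eq a b =>
    simp only [consts, fvars, Set.mem_union, Finset.mem_union] at hM he
    simp only [Sat]
    rw [a.eval_congr (fun s c h => hM s c (.inl h)) (fun i h => he i (.inl h)),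
      b.eval_congr (fun s c h => hM s c (.inr h)) (fun i h => he i (.inr h))]
  | not φ ih => exact not_congr (ih hM he)
  | and φ ψ ihφ ihψ =>
    simp only [consts, fvars, Set.mem_union, Finset.mem_union] at hM he
    exact and_congr (ihφ (fun s c h => hM s c (.inl h)) (fun i h => he i (.inl h)))
      (ihψ (fun s c h => hM s c (.inr h)) (fun i h => he i (.inr h)))
  | or φ ψ ihφ ihψ =>
    simp only [consts, fvars, Set.mem_union, Finset.mem_union] at hM he
    exact or_congr (ihφ (fun s c h => hM s c (.inl h)) (fun i h => he i (.inl h)))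
      (ihψ (fun s c h => hM s c (.inr h)) (fun i h => he i (.inr h)))
  | all j φ ih =>
    refine forall_congr' fun n => ih hM fun i hi => ?_
    rcases eq_or_ne i j with rfl | hij
    · simp only [Function.update_self]
    · simpa only [Function.update_of_ne hij] using he i (Finset.mem_erase.2 ⟨hij, hi⟩)

theorem Formula.Ground.sat_congr {M M' : Struct X} {φ : Formula X} (hφ : φ.Ground) (e e' : Env)
    (hM : ∀ s (c : Const X s), (⟨s, c⟩ : AnyConst X) ∈ φ.consts → M s c = M' s c) :
    φ.Sat M e ↔ φ.Sat M' e' :=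
  φ.sat_congr hM (by simp [hφ.2])

theorem Formula.Ground.models_of_sat {M : Struct X} {φ : Formula X} (hφ : φ.Ground) {e : Env}
    (h : φ.Sat M e) : Models M φ :=
  fun e' => (hφ.sat_congr e e' fun _ _ _ => rfl).1 h

theorem Formula.ground_and_iff {φ ψ : Formula X} : (φ.and ψ).Ground ↔ φ.Ground ∧ ψ.Ground := by
  simp only [Ground, QF, fvars, Finset.union_eq_empty]
  tauto

@[simp]
theorem Formula.sat_conj {M : Struct X} {e : Env} (l : List (Formula X)) :
    (conj l).Sat M e ↔ ∀ φ ∈ l, φ.Sat M e := by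
  induction l with
  | nil => simp [conj, Sat]
  | cons φ l ih => simpa [conj, Sat] using fun _ => ih

@[simp]
theorem Formula.qf_conj {l : List (Formula X)} : (conj l).QF ↔ ∀ φ ∈ l, φ.QF := by
  induction l with
  | nil => simp [conj, QF]
  | cons φ l ih => simpa [conj, QF] using fun _ => ih

theorem Formula.ground_conj {l : List (Formula X)} : (conj l).Ground ↔ ∀ φ ∈ l, φ.Ground := by
  induction l with
  | nil => simp [conj, Ground, QF, fvars]
  | cons φ l ih => exact ground_and_iff.trans (by rw [List.forall_mem_cons, ← ih]; rfl)

theorem Formula.qf_iff_disjuncts {φ : Formula X} : φ.QF ↔ ∀ χ ∈ φ.disjuncts, χ.QF := by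
  induction φ with
  | or φ ψ ihφ ihψ => simp only [QF, disjuncts, List.forall_mem_append, ihφ, ihψ]
  | _ => simp [QF, disjuncts]

theorem Formula.mem_fvars_iff_disjuncts {φ : Formula X} {i : ℕ} :
    i ∈ φ.fvars ↔ ∃ χ ∈ φ.disjuncts, i ∈ χ.fvars := by
  induction φ with
  | or φ ψ ihφ ihψ =>
    simp only [fvars, disjuncts, List.mem_append, Finset.mem_union, ihφ, ihψ, or_and_right,
      exists_or]
  | _ => simp [fvars, disjuncts]

theorem Formula.SubDisj.qf {φ χ : Formula X} (h : φ.SubDisj χ) (hχ : χ.QF) : φ.QF :=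
  qf_iff_disjuncts.2 fun _ hψ => qf_iff_disjuncts.1 hχ _ (h hψ)

theorem Formula.SubDisj.fvars_subset {φ χ : Formula X} (h : φ.SubDisj χ) :
    φ.fvars ⊆ χ.fvars := fun _ hi =>
  let ⟨ψ, hψ, hiψ⟩ := mem_fvars_iff_disjuncts.1 hi
  mem_fvars_iff_disjuncts.2 ⟨ψ, h hψ, hiψ⟩

/-! ### Substitution and renaming of constants -/

/-- The term that `σ` substitutes for a variable; variables outside the domain are kept. -/
def Subst.toTerm (σ : Subst X) (i : ℕ) : Term X Srt.int := (σ i).getD (.var i)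

theorem Subst.toTerm_of_eq_some {σ : Subst X} {i : ℕ} {t : Term X Srt.int} (h : σ i = some t) :
    σ.toTerm i = t := by
  rw [toTerm, h, Option.getD_some]

/-- The assignment that `σ` induces from a structure and an assignment, so that evaluating under it
amounts to substituting first. -/
def Subst.env (σ : Subst X) (M : Struct X) (e : Env) : Env := fun i => (σ.toTerm i).eval M e

theorem Term.eval_subst (σ : Subst X) (M : Struct X) (e : Env) {s : Srt} (t : Term X s) :
    (t.subst σ).eval M e = t.eval M (σ.env M e) := by
  induction t with
  | var i => rfl
  | _ => simp_all [eval, subst]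

theorem Formula.sat_subst (σ : Subst X) (M : Struct X) (e : Env) {φ : Formula X} (hφ : φ.QF) :
    (φ.subst σ).Sat M e ↔ φ.Sat M (σ.env M e) := by
  induction φ with
  | all i φ => exact hφ.elim
  | not φ ih => exact not_congr (ih hφ)
  | and φ ψ ihφ ihψ => exact and_congr (ihφ hφ.1) (ihψ hφ.2)
  | or φ ψ ihφ ihψ => exact or_congr (ihφ hφ.1) (ihψ hφ.2)
  | _ => simp [Sat, subst, Term.eval_subst]

theorem Entails.subst {φ ψ : Formula X} (h : Entails φ ψ) (hφ : φ.QF) (hψ : ψ.QF)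
    (σ : Subst X) : Entails (φ.subst σ) (ψ.subst σ) := fun M e hs =>
  (Formula.sat_subst σ M e hψ).2 (h _ _ ((Formula.sat_subst σ M e hφ).1 hs))

@[simp]
theorem Formula.qf_subst (σ : Subst X) {φ : Formula X} : (φ.subst σ).QF ↔ φ.QF := by
  induction φ generalizing σ with
  | _ => simp_all [QF, subst]

@[simp]
theorem Formula.isAtom_subst (σ : Subst X) {φ : Formula X} :
    (φ.subst σ).IsAtom ↔ φ.IsAtom := by
  cases φ <;> simp [IsAtom, subst]

@[simp]
theorem Formula.isMonomial_subst (σ : Subst X) {φ : Formula X} :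
    (φ.subst σ).IsMonomial ↔ φ.IsMonomial := by
  induction φ with
  | not φ _ => exact isAtom_subst σ
  | _ => simp_all [IsMonomial, IsLit, subst, IsAtom]

theorem Term.mem_consts_subst {σ : Subst X} {s : Srt} {t : Term X s} {c : AnyConst X} :
    c ∈ (t.subst σ).consts ↔ c ∈ t.consts ∨ ∃ i ∈ t.fvars, c ∈ (σ.toTerm i).consts := by
  induction t with
  | var i => simp [consts, subst, fvars, Subst.toTerm]
  | con c | num n => simp [consts, subst, fvars]
  | _ =>
    simp only [consts, subst, fvars, Set.mem_union, Finset.mem_union, or_and_right, exists_or,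
      or_assoc, or_left_comm, *]

theorem Formula.mem_consts_subst {σ : Subst X} {φ : Formula X} (hφ : φ.QF) {c : AnyConst X} :
    c ∈ (φ.subst σ).consts ↔ c ∈ φ.consts ∨ ∃ i ∈ φ.fvars, c ∈ (σ.toTerm i).consts := by
  induction φ with
  | all i φ _ => exact hφ.elim
  | tru | fls => simp [consts, subst, fvars]
  | not φ ih => exact ih hφ
  | and φ ψ ihφ ihψ | or φ ψ ihφ ihψ =>
    simp only [consts, subst, fvars, Set.mem_union, Finset.mem_union, or_and_right, exists_or,
      ihφ hφ.1, ihψ hφ.2, or_assoc, or_left_comm]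
  | _ =>
    simp only [consts, subst, fvars, Set.mem_union, Finset.mem_union, or_and_right, exists_or,
      Term.mem_consts_subst, or_assoc, or_left_comm]

theorem Term.fvars_subst (σ : Subst X) {s : Srt} (t : Term X s) :
    (t.subst σ).fvars = t.fvars.biUnion fun i => (σ.toTerm i).fvars := by
  induction t with
  | var i => simp only [subst, fvars, Finset.singleton_biUnion, Subst.toTerm]
  | _ => simp_all [subst, fvars, Finset.union_biUnion]

theorem Formula.fvars_subst (σ : Subst X) {φ : Formula X} (hφ : φ.QF) :
    (φ.subst σ).fvars = φ.fvars.biUnion fun i => (σ.toTerm i).fvars := by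
  induction φ with
  | all i φ _ => exact hφ.elim
  | not φ ih => exact ih hφ
  | and φ ψ ihφ ihψ | or φ ψ ihφ ihψ =>
    simp only [subst, fvars, Finset.union_biUnion, ihφ hφ.1, ihψ hφ.2]
  | _ => simp [subst, fvars, Finset.union_biUnion, Term.fvars_subst]

theorem Formula.ground_subst_iff {σ : Subst X} {φ : Formula X} :
    (φ.subst σ).Ground ↔ φ.QF ∧ ∀ i ∈ φ.fvars, (σ.toTerm i).fvars = ∅ := by
  simp only [Ground, qf_subst]
  exact and_congr_right fun hφ => by
    simp [fvars_subst σ hφ, ← Finset.not_nonempty_iff_eq_empty]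

theorem Formula.Ground.subst_of_fvars_subset {σ : Subst X} {φ ψ : Formula X}
    (hφ : (φ.subst σ).Ground) (hψ : ψ.QF) (h : ψ.fvars ⊆ φ.fvars) : (ψ.subst σ).Ground :=
  ground_subst_iff.2 ⟨hψ, fun i hi => (ground_subst_iff.1 hφ).2 i (h hi)⟩

theorem Subst.IsGround.ground_subst {σ : Subst X} (hσ : σ.IsGround) {φ : Formula X} (hφ : φ.QF)
    (h : ∀ i ∈ φ.fvars, i ∈ σ.dom) : (φ.subst σ).Ground := by
  refine Formula.ground_subst_iff.2 ⟨hφ, fun i hi => ?_⟩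
  obtain ⟨t, ht⟩ := Option.isSome_iff_exists.1 (h i hi)
  rw [toTerm_of_eq_some ht, hσ i t ht]

theorem Term.subst_empty {s : Srt} (t : Term X s) : t.subst Subst.empty = t := by
  induction t with
  | var i => rfl
  | _ => simp_all [subst]

@[simp]
theorem Formula.subst_empty (φ : Formula X) : φ.subst Subst.empty = φ := by
  induction φ with
  | all i φ ih =>
    have hupdate : Function.update (Subst.empty (X := X)) i none = Subst.empty :=
      Function.update_eq_self i _
    rw [subst, hupdate, ih]
  | _ => simp_all [subst, Term.subst_empty]

theorem Term.eval_mapC (f : ∀ s, Const X s → Const X s) (M : Struct X) (e : Env) {s : Srt}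
    (t : Term X s) : (t.mapC f).eval M e = t.eval (fun s c => M s (f s c)) e := by
  induction t with
  | _ => simp_all [eval, mapC]

theorem Formula.sat_mapC (f : ∀ s, Const X s → Const X s) (M : Struct X) (e : Env)
    (φ : Formula X) : (φ.mapC f).Sat M e ↔ φ.Sat (fun s c => M s (f s c)) e := by
  induction φ generalizing e with
  | _ => simp_all [Sat, mapC, Term.eval_mapC]

@[simp]
theorem Formula.qf_mapC (f : ∀ s, Const X s → Const X s) {φ : Formula X} :
    (φ.mapC f).QF ↔ φ.QF := by
  induction φ with
  | _ => simp_all [QF, mapC]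

@[simp]
theorem Formula.isAtom_mapC (f : ∀ s, Const X s → Const X s) {φ : Formula X} :
    (φ.mapC f).IsAtom ↔ φ.IsAtom := by
  cases φ <;> simp [IsAtom, mapC]

@[simp]
theorem Formula.isMonomial_mapC (f : ∀ s, Const X s → Const X s) {φ : Formula X} :
    (φ.mapC f).IsMonomial ↔ φ.IsMonomial := by
  induction φ with
  | not φ _ => exact isAtom_mapC f
  | _ => simp_all [IsMonomial, IsLit, mapC, IsAtom]

theorem Term.fvars_mapC (f : ∀ s, Const X s → Const X s) {s : Srt} (t : Term X s) :
    (t.mapC f).fvars = t.fvars := by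
  induction t with
  | _ => simp_all [fvars, mapC]

theorem Formula.fvars_mapC (f : ∀ s, Const X s → Const X s) (φ : Formula X) :
    (φ.mapC f).fvars = φ.fvars := by
  induction φ with
  | _ => simp_all [fvars, mapC, Term.fvars_mapC]

theorem Formula.Ground.mapC (f : ∀ s, Const X s → Const X s) {φ : Formula X} (hφ : φ.Ground) :
    (φ.mapC f).Ground :=
  ⟨(qf_mapC f).2 hφ.1, (φ.fvars_mapC f).trans hφ.2⟩

theorem Term.consts_mapC (f : ∀ s, Const X s → Const X s) {s : Srt} (t : Term X s) :
    (t.mapC f).consts = (fun c : AnyConst X => (⟨c.1, f c.1 c.2⟩ : AnyConst X)) '' t.consts := by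
  induction t with
  | _ => simp_all [consts, mapC, Set.image_union]

theorem Formula.consts_mapC (f : ∀ s, Const X s → Const X s) (φ : Formula X) :
    (φ.mapC f).consts = (fun c : AnyConst X => (⟨c.1, f c.1 c.2⟩ : AnyConst X)) '' φ.consts := by
  induction φ with
  | _ => simp_all [consts, mapC, Set.image_union, Term.consts_mapC]

theorem Formula.QF.ground_prime_skolem {m : Formula X} (hm : m.QF) : m.prime.skolem.Ground :=
  ground_subst_iff.2 ⟨(qf_mapC _).2 hm, fun _ _ => rfl⟩

theorem Formula.sat_prime_skolem {m : Formula X} (hm : m.QF) {M : Struct X} {e : Env} :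
    m.prime.skolem.Sat M e ↔
      m.Sat (fun s c => M s (c.prime s)) (fun i => M .int (.sk i)) := by
  rw [skolem, prime, sat_subst _ _ _ ((qf_mapC _).2 hm), sat_mapC]
  rfl

theorem Formula.mem_consts_prime_skolem {m : Formula X} (hm : m.QF) (hc : m.consts ⊆ curSet X)
    {c : AnyConst X} (h : c ∈ m.prime.skolem.consts) :
    c ∈ nxtSet X ∨ ∃ i ∈ m.fvars, c = ⟨.int, .sk i⟩ := by
  rw [skolem, prime, mem_consts_subst ((qf_mapC _).2 hm), consts_mapC, fvars_mapC] at h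
  refine h.imp_left ?_
  rintro ⟨c, hcm, rfl⟩
  obtain ⟨s, x, rfl⟩ := hc hcm
  exact ⟨s, x, rfl⟩

/-! ### Abstraction of constants -/

/-- `r = (ψ, σ)` is an abstraction of the ground formula `φ` over the constants in `U`: the contract
of `Abstraction.spec`, in the form in which it is applied when `φ` has no variables. -/
structure IsAbstraction (U : Set (AnyConst X)) (φ : Formula X) (r : Formula X × Subst X) :
    Prop where
  subst_eq : r.1.subst r.2 = φ
  qf : r.1.QF
  exists_const : ∀ i ∈ r.1.fvars, ∃ c : Const X .int,
    (⟨.int, c⟩ : AnyConst X) ∈ U ∧ r.2 i = some (.con c)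
  const_mem : ∀ i (c : Const X .int), r.2 i = some (.con c) → (⟨.int, c⟩ : AnyConst X) ∈ U
  injective : ∀ i j t, r.2 i = some t → r.2 j = some t → i = j
  consts_subset : r.1.consts ⊆ φ.consts \ U
  sk : ∀ i, (⟨.int, .sk i⟩ : AnyConst X) ∈ U ∩ φ.consts → r.2 i = some (.con (.sk i))

theorem Abstraction.isAbstraction (A : Abstraction X) {U : Set (AnyConst X)} {φ : Formula X}
    (hφ : φ.Ground) (hU : ∀ c ∈ φ.consts ∩ U, c.1 = .int) : IsAbstraction U φ (A.abs U φ) := by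
  obtain ⟨hsubst, hdom, hdisj, hrange, hinj, hsk⟩ := A.spec U φ hφ hU
  have hqf : (A.abs U φ).1.QF := (Formula.qf_subst _).1 (hsubst.symm ▸ hφ.1)
  refine ⟨hsubst, hqf, fun i hi => ?_, fun i c h => ?_, hinj,
    fun c hc => ⟨?_, Set.disjoint_right.1 hdisj hc⟩, hsk⟩
  · have hi' : i ∈ (A.abs U φ).2.dom := by simp [hdom, hi, hφ.2]
    obtain ⟨t, ht⟩ := Option.isSome_iff_exists.1 hi'
    obtain ⟨c, hc, rfl⟩ := hrange i t ht
    exact ⟨c, hc, ht⟩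
  · obtain ⟨c', hc', heq⟩ := hrange i _ h
    cases heq
    exact hc'
  · rw [← hsubst, Formula.mem_consts_subst hqf]
    exact .inl hc

namespace IsAbstraction

variable {U : Set (AnyConst X)} {φ : Formula X} {r : Formula X × Subst X} {i : ℕ}

open Classical in
theorem exists_agreeOff (h : IsAbstraction U φ r) {M : Struct X} {e : Env}
    (hs : r.1.Sat M e) : ∃ M', AgreeOff U M M' ∧ φ.Sat M' e := by
  let M' : Struct X
    | .int, c => if hc : ∃ i, r.2 i = some (.con c) then e hc.choose else M _ c
    | .arr, c => M _ c
  have hM' : AgreeOff U M M' := by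
    rintro (_ | _) c hc
    · have hnot : ¬ ∃ i, r.2 i = some (.con c) := fun ⟨i, hi⟩ => hc (h.const_mem i c hi)
      simp only [M', dif_neg hnot]
    · rfl
  refine ⟨M', hM', ?_⟩
  rw [← h.subst_eq, Formula.sat_subst _ _ _ h.qf]
  refine (r.1.sat_congr (fun s c hc => hM' s c (h.consts_subset hc).2) fun i hi => ?_).1 hs
  obtain ⟨c, -, hic⟩ := h.exists_const i hi
  have hc : ∃ i, r.2 i = some (.con c) := ⟨i, hic⟩
  calc e i = e hc.choose := by rw [h.injective _ _ _ hc.choose_spec hic]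
    _ = M' _ c := by simp only [M', dif_pos hc]
    _ = r.2.env M' e i := by rw [Subst.env, Subst.toTerm_of_eq_some hic]; rfl

theorem const_mem_consts (h : IsAbstraction U φ r) (hi : i ∈ r.1.fvars) {c : Const X .int}
    (hic : r.2 i = some (.con c)) : (⟨.int, c⟩ : AnyConst X) ∈ φ.consts := by
  rw [← h.subst_eq, Formula.mem_consts_subst h.qf]
  exact .inr ⟨i, hi, by rw [Subst.toTerm_of_eq_some hic]; rfl⟩

theorem inst_eq_sk (h : IsAbstraction (skSet X) φ r) (hi : i ∈ r.1.fvars) :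
    r.2 i = some (.con (.sk i)) := by
  obtain ⟨c, ⟨j, hj⟩, hic⟩ := h.exists_const i hi
  cases hj
  obtain rfl := h.injective _ _ _ hic (h.sk j ⟨⟨j, rfl⟩, h.const_mem_consts hi hic⟩)
  exact hic

end IsAbstraction

/-- The structure obtained from `M` by interpreting the Skolem constant `sk i` as `e i`. -/
def Struct.withSkolem (M : Struct X) (e : Env) : Struct X
  | _, .cur x => M _ (.cur x)
  | _, .nxt x => M _ (.nxt x)
  | _, .sk i => e i

theorem IsAbstraction.sat_withSkolem {φ : Formula X} {r : Formula X × Subst X}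
    (h : IsAbstraction (skSet X) φ r) {M : Struct X} {e : Env} :
    φ.Sat (M.withSkolem e) e ↔ r.1.Sat M e := by
  rw [← h.subst_eq, Formula.sat_subst _ _ _ h.qf]
  refine r.1.sat_congr (fun s c hc => ?_) fun i hi => ?_
  · cases c with
    | cur x | nxt x => rfl
    | sk i => exact ((h.consts_subset hc).2 ⟨i, rfl⟩).elim
  · rw [Subst.env, Subst.toTerm_of_eq_some (h.inst_eq_sk hi)]
    rfl

/-! ### States and paths to `Bad` -/

/-- The pre-state of a structure. -/
def Struct.state (M : Struct X) : State X := fun _ x => M _ (.cur x)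

/-- The post-state of a structure. -/
def Struct.nextState (M : Struct X) : State X := fun _ x => M _ (.nxt x)

theorem Formula.sat_congr_state {φ : Formula X} (hφ : φ.consts ⊆ curSet X) {M M' : Struct X}
    (h : M.state = M'.state) {e : Env} : φ.Sat M e ↔ φ.Sat M' e := by
  refine φ.sat_congr (fun s c hc => ?_) fun _ _ => rfl
  obtain ⟨_, x, hx⟩ := hφ hc
  cases hx
  exact congrFun (congrFun h _) x

theorem Formula.Ground.models_pair_state {φ : Formula X} (hφ : φ.Ground)
    (hc : φ.consts ⊆ curSet X) {M : Struct X} {e : Env} (h : φ.Sat M e) (b : State X) :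
    Models (State.pair M.state b) φ :=
  hφ.models_of_sat ((sat_congr_state hc (M := M) (M' := State.pair M.state b) rfl).1 h)

theorem SafetyProblem.models_pair_tr (P : SafetyProblem X) {M : Struct X} {e : Env}
    (h : P.tr.Sat M e) : Models (State.pair M.state M.nextState) P.tr := by
  refine P.tr_ground.models_of_sat ((P.tr_ground.sat_congr e e fun s c hc => ?_).1 h)
  rcases P.tr_consts hc with ⟨_, _, hx⟩ | ⟨_, _, hx⟩ <;> cases hx <;> rfl

/-- A bad state is reached from the state `a` by a path of `k` transitions. -/
def SafetyProblem.ReachesBad (P : SafetyProblem X) (k : ℕ) (a : State X) : Prop :=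
  ∃ f : ℕ → State X, f 0 = a ∧ (∀ i < k, Models (State.pair (f i) (f (i + 1))) P.tr) ∧
    Models (State.pair (f k) (f k)) P.bad

theorem SafetyProblem.reachesBad_zero_of_sat {P : SafetyProblem X} {M : Struct X} {e : Env}
    (h : P.bad.Sat M e) : P.ReachesBad 0 M.state :=
  ⟨fun _ => M.state, rfl, fun _ hi => absurd hi (Nat.not_lt_zero _),
    P.bad_ground.models_pair_state P.bad_consts h _⟩

theorem SafetyProblem.ReachesBad.cons {P : SafetyProblem X} {k : ℕ} {a b : State X}
    (h : P.ReachesBad k b) (hab : Models (State.pair a b) P.tr) : P.ReachesBad (k + 1) a := by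
  obtain ⟨f, rfl, hf, hbad⟩ := h
  refine ⟨fun n => Nat.casesOn n a f, rfl, fun i hi => ?_, hbad⟩
  cases i with
  | zero => exact hab
  | succ i => exact hf i (Nat.lt_of_succ_lt_succ hi)

theorem SafetyProblem.ReachesBad.hasCounterexample {P : SafetyProblem X} {k : ℕ} {M : Struct X}
    {e : Env} (h : P.ReachesBad k M.state) (hM : P.init.Sat M e) : P.HasCounterexample k := by
  obtain ⟨f, hf, htr_bad⟩ := h
  exact ⟨f, hf ▸ P.init_ground.models_pair_state P.init_consts hM _, htr_bad⟩

/-! ### Proof obligations -/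

/-- The formulas that occur in proof obligations: quantifier-free monomials over the (unprimed)
program variables. Variables may occur. -/
structure Formula.IsCube (m : Formula X) : Prop where
  isMonomial : m.IsMonomial
  qf : m.QF
  consts_subset : m.consts ⊆ curSet X

theorem SafetyProblem.ground_preFormula (P : SafetyProblem X) {m : Formula X} (hm : m.QF) :
    (P.preFormula m).Ground :=
  Formula.ground_and_iff.2 ⟨P.tr_ground, hm.ground_prime_skolem⟩

theorem SafetyProblem.consts_preFormula_subset (P : SafetyProblem X) {m : Formula X} (hm : m.QF)
    (hc : m.consts ⊆ curSet X) : (P.preFormula m).consts ⊆ curSet X ∪ (nxtSet X ∪ skSet X) := by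
  rintro c (h | h)
  · exact (P.tr_consts h).imp_right .inl
  · rcases Formula.mem_consts_prime_skolem hm hc h with h | ⟨i, -, h⟩
    · exact .inr (.inl h)
    · exact .inr (.inr ⟨i, h⟩)

section Predecessor

variable {P : SafetyProblem X} {B : MBP X} {A : Abstraction X} {m : Formula X} {M : Struct X}

theorem SafetyProblem.isAbstraction_project (hm : m.QF) (hM : Models M (P.preFormula m))
    (hint : ∀ c ∈ (P.project B m M).2, c.1 = .int) :
    IsAbstraction (P.project B m M).2 (P.project B m M).1
      (A.abs (P.project B m M).2 (P.project B m M).1) :=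
  A.isAbstraction (B.ground_monomial _ _ _ (P.ground_preFormula hm) hM).2 fun c hc => hint c hc.2

theorem SafetyProblem.subst_predecessor (hm : m.QF) (hM : Models M (P.preFormula m))
    (hint : ∀ c ∈ (P.project B m M).2, c.1 = .int) (i : ℕ) :
    (P.predecessor B A m M i).body.subst (P.predecessor B A m M i).inst = (P.project B m M).1 :=
  (isAbstraction_project hm hM hint).subst_eq

theorem SafetyProblem.isCube_predecessor (hm : m.IsCube) (hM : Models M (P.preFormula m))
    (hint : ∀ c ∈ (P.project B m M).2, c.1 = .int) (i : ℕ) :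
    (P.predecessor B A m M i).body.IsCube := by
  have hpre := P.ground_preFormula hm.qf
  have habs := isAbstraction_project (A := A) hm.qf hM hint
  refine ⟨?_, habs.qf, fun c hc => ?_⟩
  · rw [← Formula.isMonomial_subst (P.predecessor B A m M i).inst,
      subst_predecessor hm.qf hM hint]
    exact (B.ground_monomial _ _ _ hpre hM).1
  · obtain ⟨hcψ, hcW⟩ := habs.consts_subset hc
    obtain ⟨hcpre, hcU⟩ := (B.consts_sub _ _ _ hpre hM).2 hcψ
    exact (P.consts_preFormula_subset hm.qf hm.consts_subset hcpre).resolve_right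
      fun h => hcU ⟨h, hcW⟩

theorem SafetyProblem.ground_subst_predecessor (hm : m.QF) (hM : Models M (P.preFormula m))
    (hint : ∀ c ∈ (P.project B m M).2, c.1 = .int) (i : ℕ) :
    ((P.predecessor B A m M i).body.subst (P.predecessor B A m M i).inst).Ground := by
  rw [subst_predecessor hm hM hint]
  exact (B.ground_monomial _ _ _ (P.ground_preFormula hm) hM).2

theorem SafetyProblem.models_subst_predecessor (hm : m.QF) (hM : Models M (P.preFormula m))
    (hint : ∀ c ∈ (P.project B m M).2, c.1 = .int) (i : ℕ) :
    Models M ((P.predecessor B A m M i).body.subst (P.predecessor B A m M i).inst) := by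
  rw [subst_predecessor hm hM hint]
  exact B.models _ _ _ (P.ground_preFormula hm) hM

theorem SafetyProblem.exists_tr_of_sat_predecessor (hm : m.QF) (hM : Models M (P.preFormula m))
    (hint : ∀ c ∈ (P.project B m M).2, c.1 = .int) {i : ℕ} {M₁ : Struct X} {e : Env}
    (h : (P.predecessor B A m M i).body.Sat M₁ e) :
    ∃ M₂ e₂, Models (State.pair M₁.state M₂.state) P.tr ∧ m.Sat M₂ e₂ := by
  have hpre := P.ground_preFormula hm
  obtain ⟨M', hagree, hψ⟩ := (isAbstraction_project hm hM hint).exists_agreeOff h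
  obtain ⟨M'', hagree', hM''⟩ := B.under _ _ _ hpre hM M'
    ((B.ground_monomial _ _ _ hpre hM).2.models_of_sat hψ)
  have hcur {s : Srt} (x : X s) : (⟨s, .cur x⟩ : AnyConst X) ∉ nxtSet X ∪ skSet X := by
    rintro (⟨_, _, h⟩ | ⟨_, h⟩) <;> cases h
  have hstate : M₁.state = M''.state := by
    funext s x
    exact (hagree s _ fun h => hcur x ((B.consts_sub _ _ _ hpre hM).1 h)).trans
      (hagree' s _ fun h => hcur x h.1)
  obtain ⟨htr, hm'⟩ := hM'' e
  exact ⟨_, _, hstate ▸ P.models_pair_tr htr, (Formula.sat_prime_skolem hm).1 hm'⟩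

theorem SafetyProblem.finite_predecessors (P : SafetyProblem X) (B : MBP X) (A : Abstraction X)
    (hm : m.QF) (i : ℕ) :
    {q | ∃ M, Models M (P.preFormula m) ∧ q = P.predecessor B A m M i}.Finite := by
  refine ((B.finite_range (nxtSet X ∪ skSet X) _ (P.ground_preFormula hm)).image
    fun r => (⟨(A.abs r.2 r.1).1, (A.abs r.2 r.1).2, i⟩ : POB X)).subset ?_
  rintro _ ⟨M, hM, rfl⟩
  exact ⟨_, ⟨M, hM, rfl⟩, rfl⟩

theorem SafetyProblem.Arises.isCube (hbad : P.bad.IsMonomial) (harr : P.EliminatesArrays B A)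
    (hm : P.Arises B A m) : m.IsCube := by
  induction hm with
  | bad => exact ⟨hbad, P.bad_ground.1, P.bad_consts⟩
  | pred m M i hm hM ih => exact isCube_predecessor ih hM (harr m M hm hM) i

end Predecessor

/-- The proof obligations that can be raised while the level is `N`: `Bad` at level `N`, and the
predecessors of such obligations, one level below. -/
inductive SafetyProblem.IsObligation (P : SafetyProblem X) (B : MBP X) (A : Abstraction X)
    (N : ℕ) : POB X → Prop
  | bad : P.IsObligation B A N ⟨P.bad, Subst.empty, N⟩
  | predecessor {p : POB X} {i : ℕ} {M : Struct X} (hp : P.IsObligation B A N p)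
      (hi : p.level = i + 1) (hM : Models M (P.preFormula p.body)) :
      P.IsObligation B A N (P.predecessor B A p.body M i)

namespace SafetyProblem.IsObligation

variable {P : SafetyProblem X} {B : MBP X} {A : Abstraction X} {N : ℕ} {p : POB X}

theorem arises (h : P.IsObligation B A N p) : P.Arises B A p.body := by
  induction h with
  | bad => exact .bad
  | predecessor _ _ hM ih => exact .pred _ _ _ ih hM

theorem level_le (h : P.IsObligation B A N p) : p.level ≤ N := by
  induction h with
  | bad => exact le_rfl
  | predecessor _ hi _ ih => exact (Nat.le_succ _).trans (hi.symm.trans_le ih)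

theorem isCube (h : P.IsObligation B A N p) (hbad : P.bad.IsMonomial)
    (harr : P.EliminatesArrays B A) : p.body.IsCube :=
  h.arises.isCube hbad harr

theorem ground_subst (h : P.IsObligation B A N p) (hbad : P.bad.IsMonomial)
    (harr : P.EliminatesArrays B A) : (p.body.subst p.inst).Ground := by
  cases h with
  | bad => exact P.bad.subst_empty.symm ▸ P.bad_ground
  | predecessor hp _ hM =>
    exact ground_subst_predecessor (hp.isCube hbad harr).qf hM (harr _ _ hp.arises hM) _

theorem reachesBad (h : P.IsObligation B A N p) (hbad : P.bad.IsMonomial)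
    (harr : P.EliminatesArrays B A) {M : Struct X} {e : Env} (hs : p.body.Sat M e) :
    P.ReachesBad (N - p.level) M.state := by
  induction h generalizing M e with
  | bad => exact (Nat.sub_self N).symm ▸ reachesBad_zero_of_sat hs
  | @predecessor p i M' hp hi hM' ih =>
    obtain ⟨M₂, e₂, htr, hs₂⟩ := exists_tr_of_sat_predecessor (hp.isCube hbad harr).qf hM'
      (harr _ _ hp.arises hM') hs
    have hlevel : N - i = N - p.level + 1 := by have := hp.level_le; omega
    exact hlevel.symm ▸ (ih hs₂).cons htr

theorem finite (N : ℕ) (hbad : P.bad.IsMonomial) (harr : P.EliminatesArrays B A) :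
    {p | P.IsObligation B A N p}.Finite := by
  have hlevel (d : ℕ) : {p | P.IsObligation B A N p ∧ p.level + d = N}.Finite := by
    induction d with
    | zero =>
      refine (Set.finite_singleton ⟨P.bad, Subst.empty, N⟩).subset ?_
      rintro _ ⟨_ | @⟨q, i, M, hq, hi, hM⟩, hlevel⟩
      · rfl
      · have hle := hq.level_le
        have hN : i + 0 = N := hlevel
        omega
    | succ d ih =>
      refine (ih.biUnion fun q hq => finite_predecessors P B A (hq.1.isCube hbad harr).qf
        (q.level - 1)).subset ?_
      rintro _ ⟨_ | @⟨q, i, M, hq, hi, hM⟩, hlevel⟩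
      · exact absurd hlevel (by simp)
      · have hN : i + (d + 1) = N := hlevel
        exact Set.mem_biUnion (show q ∈ _ from ⟨hq, by omega⟩) ⟨M, hM, by simp [hi]⟩
  refine ((Set.finite_Iic N).biUnion fun d _ => hlevel d).subset fun p hp => ?_
  exact Set.mem_biUnion (Nat.sub_le N p.level) ⟨hp, Nat.add_sub_of_le hp.level_le⟩

end SafetyProblem.IsObligation

/-! ### Frames and blocking lemmas -/

theorem qi_ground_iff {Q : Frame X} :
    (qi Q).Ground ↔ ∀ l ∈ Q, (l.body.subst l.inst).Ground := by
  rw [qi, Formula.ground_conj, List.forall_mem_map]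

theorem sat_qi {Q : Frame X} {M : Struct X} {e : Env} :
    (qi Q).Sat M e ↔ ∀ l ∈ Q, (l.body.subst l.inst).Sat M e := by
  rw [qi, Formula.sat_conj, List.forall_mem_map]

theorem Trace.subset_add (Q : Trace X) (i : ℕ) (l : FrameLemma X) (j : ℕ) :
    Q j ⊆ Q.add i l j := by
  unfold Trace.add
  split
  · exact List.subset_cons_self _ _
  · exact List.Subset.refl _

theorem Trace.mem_add_self (Q : Trace X) (i : ℕ) (l : FrameLemma X) : l ∈ Q.add i l i := by
  rw [Trace.add, if_pos le_rfl]
  exact List.mem_cons_self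

/-- The frame at the level of the proof obligation `p` excludes its ground instance. -/
def POB.Blocked (p : POB X) (Q : Trace X) : Prop :=
  Entails (qi (Q p.level)) (p.body.subst p.inst).not

theorem POB.Blocked.mono {p : POB X} {Q Q' : Trace X} (h : p.Blocked Q) (hQ : ∀ j, Q j ⊆ Q' j) :
    p.Blocked Q' :=
  fun M e hM => h M e (sat_qi.2 fun l hl => sat_qi.1 hM l (hQ _ hl))

/-- The instance of the lemma `l` is ground and excludes the ground instance of the proof
obligation `p`, so that `l` may be added to the frames in order to block `p`. -/
structure FrameLemma.Blocks (l : FrameLemma X) (p : POB X) : Prop where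
  ground : (l.body.subst l.inst).Ground
  entails : Entails (l.body.subst l.inst) (p.body.subst p.inst).not

theorem FrameLemma.Blocks.blocked_add {l : FrameLemma X} {p : POB X} (h : l.Blocks p)
    (Q : Trace X) : p.Blocked (Q.add p.level l) :=
  fun M e hM => h.entails M e (sat_qi.1 hM l (Q.mem_add_self _ _))

theorem QGenCandidate.blocks {ℓ : Formula X} {p : POB X} {c : FrameLemma X}
    (h : QGenCandidate ℓ p.inst c) (hℓ : FrameLemma.Blocks ⟨ℓ, p.inst⟩ p) : c.Blocks p := by
  obtain ⟨hqf, -, hdom, hground, hequiv, -⟩ := h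
  exact ⟨hground.ground_subst hqf hdom, fun M e hM => hℓ.entails M e ((hequiv M e).1 hM)⟩

theorem Pushable.ground {Q Q' : Frame X} {c : FrameLemma X} (h : Pushable Q Q' c)
    (hQ : (qi Q).Ground) : (c.body.subst c.inst).Ground := by
  obtain ⟨⟨l, hl, hinst, hsub⟩, -⟩ := h
  have hground := qi_ground_iff.1 hQ l hl
  exact hinst ▸ hground.subst_of_fvars_subset (hsub.qf ((Formula.qf_subst _).1 hground.1))
    hsub.fvars_subset

section BlockingLemma

variable {φ m : Formula X}

theorem Interpolation.consts_itp_subset_right (I : Interpolation X) (hφ : φ.Ground)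
    (hm : m.Ground) (hmono : m.IsMonomial) (h : Entails φ m.not) :
    (I.itp φ m).1.consts ⊆ m.consts := by
  obtain ⟨hU, hsub⟩ := I.consts_sub φ m hφ hm hmono h
  exact hsub.trans (Set.union_subset Set.inter_subset_right fun c hc => (hU hc).1)

theorem Formula.IsCube.isMonomial_prime_skolem (hm : m.IsCube) :
    m.prime.skolem.IsMonomial :=
  (isMonomial_subst _).2 ((isMonomial_mapC _).2 hm.isMonomial)

theorem Abstraction.isAbstraction_unprime (A : Abstraction X) {L : Formula X} (hL : L.Ground) :
    IsAbstraction (skSet X) L.unprime (A.abs (skSet X) L.unprime) :=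
  A.isAbstraction (hL.mapC _) fun _ ⟨_, _, hc⟩ => hc ▸ rfl

theorem Formula.sk_mem_consts_of_unprime {L : Formula X} {i : ℕ}
    (h : (⟨.int, .sk i⟩ : AnyConst X) ∈ L.unprime.consts) :
    (⟨.int, .sk i⟩ : AnyConst X) ∈ L.consts := by
  rw [unprime, consts_mapC] at h
  obtain ⟨⟨_, _ | _ | _⟩, hc, heq⟩ := h <;> cases heq
  exact hc

theorem Formula.sat_prime_skolem_unprime_withSkolem (hm : m.IsCube) {M : Struct X} {e : Env} :
    m.prime.skolem.Sat (fun s c => M.withSkolem e s (c.unprime s)) e ↔ m.Sat M e := by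
  have hstate : Struct.state (fun s c => M.withSkolem e s ((c.prime s).unprime s)) = M.state := rfl
  exact (sat_prime_skolem hm.qf).trans (sat_congr_state hm.consts_subset hstate)

variable {P : SafetyProblem X} {I : Interpolation X} {A : Abstraction X} {Q : Frame X}

theorem SafetyProblem.isAbstraction_blockingLemma (hQ : (qi Q).Ground) (hm : m.IsCube)
    (h : Entails ((qi Q).and P.tr) m.prime.skolem.not) :
    IsAbstraction (skSet X) (I.itp ((qi Q).and P.tr) m.prime.skolem).1.unprime
      (A.abs (skSet X) (I.itp ((qi Q).and P.tr) m.prime.skolem).1.unprime) :=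
  A.isAbstraction_unprime (I.ground_clause _ _ (Formula.ground_and_iff.2 ⟨hQ, P.tr_ground⟩)
    hm.qf.ground_prime_skolem hm.isMonomial_prime_skolem h).2

theorem SafetyProblem.fvars_blockingLemma_subset (hQ : (qi Q).Ground) (hm : m.IsCube)
    (h : Entails ((qi Q).and P.tr) m.prime.skolem.not) :
    (P.blockingLemma I A Q m).fvars ⊆ m.fvars := fun i hi => by
  have habs := isAbstraction_blockingLemma (I := I) (A := A) hQ hm h
  have hmem := I.consts_itp_subset_right (Formula.ground_and_iff.2 ⟨hQ, P.tr_ground⟩)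
    hm.qf.ground_prime_skolem hm.isMonomial_prime_skolem h
    (Formula.sk_mem_consts_of_unprime (habs.const_mem_consts hi (habs.inst_eq_sk hi)))
  rcases Formula.mem_consts_prime_skolem hm.qf hm.consts_subset hmem with
    ⟨_, _, heq⟩ | ⟨j, hj, heq⟩
  · cases heq
  · cases heq
    exact hj

theorem SafetyProblem.blockingLemma_entails_not (hQ : (qi Q).Ground) (hm : m.IsCube)
    (h : Entails ((qi Q).and P.tr) m.prime.skolem.not) :
    Entails (P.blockingLemma I A Q m) m.not := fun M e hℓ hmM => by
  have hL := (isAbstraction_blockingLemma (I := I) (A := A) hQ hm h).sat_withSkolem.2 hℓ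
  rw [Formula.unprime, Formula.sat_mapC] at hL
  exact I.right _ _ (Formula.ground_and_iff.2 ⟨hQ, P.tr_ground⟩) hm.qf.ground_prime_skolem
    hm.isMonomial_prime_skolem h _ _ hL ((Formula.sat_prime_skolem_unprime_withSkolem hm).2 hmM)

theorem SafetyProblem.blocks_blockingLemma {p : POB X} (hQ : (qi Q).Ground)
    (hp : p.body.IsCube) (hground : (p.body.subst p.inst).Ground)
    (h : Entails ((qi Q).and P.tr) p.body.prime.skolem.not) :
    FrameLemma.Blocks ⟨P.blockingLemma I A Q p.body, p.inst⟩ p :=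
  have hqf := (isAbstraction_blockingLemma (I := I) (A := A) hQ hp h).qf
  ⟨hground.subst_of_fvars_subset hqf (fvars_blockingLemma_subset hQ hp h),
    (blockingLemma_entails_not hQ hp h).subst hqf hp.qf p.inst⟩

end BlockingLemma

/-! ### The invariant -/

section Run

variable {P : SafetyProblem X} {S : Solver X} {B : MBP X} {I : Interpolation X}
  {A : Abstraction X} {N : ℕ} {Q : Trace X} {queue : Set (POB X)} {p : POB X}

/-- The invariant of the queue at level `N`: its elements are proof obligations of that level, and
those at level `0` are satisfied by an initial state. -/
def QueueInv (P : SafetyProblem X) (B : MBP X) (A : Abstraction X) (N : ℕ)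
    (queue : Set (POB X)) : Prop :=
  ∀ p ∈ queue, P.IsObligation B A N p ∧ (p.level = 0 → Satisfiable (P.init.and p.body))

/-- The control part of the invariant of `Quic3_Main`. -/
def ControlInv (P : SafetyProblem X) (B : MBP X) (A : Abstraction X) (N : ℕ) : Control X → Prop
  | .start => N = 0
  | .makeSafe queue => QueueInv P B A N queue
  | .qgen queue p ℓ cands =>
    QueueInv P B A N queue ∧ FrameLemma.Blocks ⟨ℓ, p.inst⟩ p ∧ ∀ c ∈ cands, c.Blocks p
  | .pushing i _ _ => i < N
  | .ret .cex => P.HasCounterexample N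
  | .hang => False
  | .loop | .push _ | .ret .safe => True

/-- The trace part of the invariant of `Quic3_Main`. -/
structure TraceInv (P : SafetyProblem X) (Q : Trace X) : Prop where
  ground : ∀ i, (qi (Q i)).Ground
  init_mem : ⟨P.init, Subst.empty⟩ ∈ Q 0

/-- The invariant of `Quic3_Main`. -/
structure Config.Inv (P : SafetyProblem X) (B : MBP X) (A : Abstraction X) (c : Config X) :
    Prop where
  trace : TraceInv P c.trace
  ctrl : ControlInv P B A c.N c.ctrl

theorem SafetyProblem.inv_initial (P : SafetyProblem X) (B : MBP X) (A : Abstraction X) :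
    P.initial.Inv P B A := by
  refine ⟨⟨fun i => qi_ground_iff.2 fun l hl => ?_, List.mem_singleton.2 rfl⟩, rfl⟩
  obtain ⟨-, rfl⟩ : i = 0 ∧ l = ⟨P.init, Subst.empty⟩ := by simpa [initial] using hl
  exact P.init.subst_empty.symm ▸ P.init_ground

theorem TraceInv.add (hQ : TraceInv P Q) (i : ℕ) {l : FrameLemma X}
    (hl : (l.body.subst l.inst).Ground) : TraceInv P (Q.add i l) := by
  refine ⟨fun j => ?_, Q.subset_add _ _ _ hQ.init_mem⟩
  unfold Trace.add
  split
  · exact Formula.ground_and_iff.2 ⟨hl, hQ.ground j⟩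
  · exact hQ.ground j

theorem TraceInv.update_nil (hQ : TraceInv P Q) (n : ℕ) :
    TraceInv P (Function.update Q (n + 1) []) := by
  refine ⟨fun j => ?_, by simpa only [Function.update_of_ne n.succ_ne_zero.symm] using hQ.init_mem⟩
  rcases eq_or_ne j (n + 1) with rfl | hj
  · rw [Function.update_self]
    exact ⟨trivial, rfl⟩
  · rw [Function.update_of_ne hj]
    exact hQ.ground j

theorem TraceInv.sat_init (hQ : TraceInv P Q) {M : Struct X} {e : Env}
    (h : (qi (Q 0)).Sat M e) : P.init.Sat M e := by
  simpa only [Formula.subst_empty] using sat_qi.1 h _ hQ.init_mem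

theorem Solver.models_preFormula (hm : p.body.QF) {φ : Formula X} {M : Struct X}
    (h : S.call (φ.and (P.preFormula p.body)) (.sat M)) : Models M (P.preFormula p.body) :=
  let ⟨_, _, hpre⟩ := S.sat_sound _ _ h
  (P.ground_preFormula hm).models_of_sat hpre

theorem SafetyProblem.IsObligation.models_predecessor (hp : P.IsObligation B A N p)
    (hbad : P.bad.IsMonomial) (harr : P.EliminatesArrays B A) {M : Struct X}
    (hM : Models M (P.preFormula p.body)) (i : ℕ) :
    Models M ((P.predecessor B A p.body M i).body.subst (P.predecessor B A p.body M i).inst) :=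
  models_subst_predecessor (hp.isCube hbad harr).qf hM (harr _ _ hp.arises hM) i

theorem QueueInv.insert_predecessor (hq : QueueInv P B A N queue) (hQ : TraceInv P Q)
    (hbad : P.bad.IsMonomial) (harr : P.EliminatesArrays B A) (hp : p ∈ queue) {i : ℕ}
    (hi : p.level = i + 1) {M : Struct X}
    (h : S.call ((qi (Q i)).and (P.preFormula p.body)) (.sat M)) :
    QueueInv P B A N (insert (P.predecessor B A p.body M i) queue) := by
  have hp := (hq p hp).1
  have hM := S.models_preFormula (hp.isCube hbad harr).qf h
  have hpred := hp.predecessor hi hM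
  refine Set.forall_mem_insert.2 ⟨⟨hpred, fun (hi₀ : i = 0) => ?_⟩, hq⟩
  subst hi₀
  obtain ⟨e, hqi, -⟩ := S.sat_sound _ _ h
  have hbody := (Formula.sat_subst _ M e (hpred.isCube hbad harr).qf).1
    (hp.models_predecessor hbad harr hM 0 e)
  exact ⟨M, _, P.init_ground.models_of_sat (hQ.sat_init hqi) _, hbody⟩

theorem QueueInv.hasCounterexample (hq : QueueInv P B A N queue) (hbad : P.bad.IsMonomial)
    (harr : P.EliminatesArrays B A) (hp : p ∈ queue) (hlevel : p.level = 0) :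
    P.HasCounterexample N := by
  obtain ⟨hob, hsat⟩ := hq p hp
  obtain ⟨M, e, hinit, hbody⟩ := hsat hlevel
  have hreach := hob.reachesBad hbad harr hbody
  rw [hlevel] at hreach
  exact hreach.hasCounterexample hinit

theorem SafetyProblem.qf_pushQuery (P : SafetyProblem X) {Q : Frame X} (hQ : (qi Q).Ground)
    (ρs : List (Subst X)) {φ : Formula X} (hφ : φ.QF) : (P.pushQuery Q ρs φ).QF := by
  simp only [pushQuery, Formula.qf_conj, List.forall_mem_cons, List.forall_mem_map,
    Formula.qf_subst]
  exact ⟨fun _ _ => hφ, fun l hl _ _ => (Formula.qf_subst _).1 (qi_ground_iff.1 hQ l hl).1,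
    hQ.1, P.tr_ground.1, (Formula.qf_mapC _).2 hφ, List.forall_mem_nil _⟩

theorem SafetyProblem.qf_qgenQuery (P : SafetyProblem X) {φ ψ : Formula X} (hφ : φ.QF)
    (hψ : ψ.QF) : ((P.fwd φ).and ψ.prime.not).QF :=
  ⟨⟨⟨hφ, P.tr_ground.1⟩, (Formula.qf_mapC _).2 P.init_ground.1⟩, (Formula.qf_mapC _).2 hψ⟩

theorem Step.ctrl_ne_hang {c c' : Config X} (hbad : P.bad.IsMonomial)
    (harr : P.EliminatesArrays B A) (hc : c.Inv P B A) (h : Step P S B I A c c') :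
    c'.ctrl ≠ .hang := by
  obtain ⟨hQ, hctrl⟩ := hc
  cases h with
  | start_hang N Q h => exact absurd h (S.terminates _ ⟨P.init_ground.1, P.bad_ground.1⟩)
  | block_hang N Q queue p i hp hi h =>
    have hm := ((hctrl p hp.1).1.isCube hbad harr).qf
    exact absurd h (S.terminates _ ⟨(hQ.ground i).1, (P.ground_preFormula hm).1⟩)
  | qgen_hang N Q queue p ℓ c cs h =>
    have hc := (hctrl.2.2 c List.mem_cons_self).ground.1
    exact absurd h (S.terminates _
      (P.qf_qgenQuery (hQ.ground _).1 ((Formula.qf_subst _).1 hc)))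
  | pushing_init_hang N Q i ρs c cs hp h =>
    have hc := (hp.ground (hQ.ground i)).1
    exact absurd h (S.terminates _ ⟨P.init_ground.1, (Formula.qf_subst _).1 hc⟩)
  | pushing_hang N Q i ρs c cs hp hinit h =>
    have hc := (hp.ground (hQ.ground i)).1
    exact absurd h (S.terminates _
      (P.qf_pushQuery (hQ.ground i) ρs ((Formula.qf_subst _).1 hc)))
  | hang => exact hctrl.elim
  | _ => nofun

theorem Step.traceInv {c c' : Config X} (hc : c.Inv P B A) (h : Step P S B I A c c') :
    TraceInv P c'.trace := by
  obtain ⟨hQ, hctrl⟩ := hc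
  cases h with
  | unfold => exact hQ.update_nil _
  | qgen_none => exact hQ.add _ hctrl.2.1.ground
  | qgen_ok N Q queue p ℓ c => exact hQ.add _ (hctrl.2.2 c List.mem_cons_self).ground
  | pushing_ok N Q i ρs c cs hp => exact hQ.add _ (hp.ground (hQ.ground i))
  | _ => exact hQ

theorem Step.controlInv {c c' : Config X} (hbad : P.bad.IsMonomial)
    (harr : P.EliminatesArrays B A) (hc : c.Inv P B A) (h : Step P S B I A c c') :
    ControlInv P B A c'.N c'.ctrl := by
  have hhang := h.ctrl_ne_hang hbad harr hc
  obtain ⟨hQ, hctrl⟩ := hc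
  cases h with
  | start_hang | block_hang | qgen_hang | pushing_init_hang | pushing_hang | hang =>
    exact absurd rfl hhang
  | start_unsat | blocked | push_safe | push_done | pushing_nil => trivial
  | start_sat N Q M h =>
    obtain rfl : N = 0 := hctrl
    obtain ⟨e, hinit, hsat⟩ := S.sat_sound _ _ h
    exact (SafetyProblem.reachesBad_zero_of_sat hsat).hasCounterexample hinit
  | unfold N Q =>
    rintro p rfl
    exact ⟨.bad, fun h => absurd h N.succ_ne_zero⟩
  | cex N Q queue p hp hlevel => exact QueueInv.hasCounterexample hctrl hbad harr hp.1 hlevel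
  | predecessor N Q queue p i M hp hi h =>
    exact QueueInv.insert_predecessor hctrl hQ hbad harr hp.1 hi h
  | block N Q queue p i cands hp hi h hcands =>
    have hob := (hctrl p hp.1).1
    have hblocks := SafetyProblem.blocks_blockingLemma (I := I) (A := A) (hQ.ground i)
      (hob.isCube hbad harr) (hob.ground_subst hbad harr)
      fun M e hA hm => S.unsat_sound _ h ⟨M, e, hA.1, hA.2, hm⟩
    exact ⟨fun q hq => hctrl q hq.1, hblocks, fun c hc => (hcands c hc).blocks hblocks⟩
  | qgen_none | qgen_ok => exact hctrl.1
  | qgen_fail =>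
    exact ⟨hctrl.1, hctrl.2.1, fun c hc => hctrl.2.2 c (List.mem_cons_of_mem _ hc)⟩
  | push_frame N Q i ρs cands hi => exact hi
  | pushing_skip | pushing_init_fail | pushing_fail | pushing_ok => exact hctrl

theorem Step.inv {c c' : Config X} (hbad : P.bad.IsMonomial) (harr : P.EliminatesArrays B A)
    (hc : c.Inv P B A) (h : Step P S B I A c c') : c'.Inv P B A :=
  ⟨h.traceInv hc, h.controlInv hbad harr hc⟩

/-! ### Termination at a fixed level -/

/-- The proof obligations of level `N` outside `T` that are not blocked yet, and may therefore
still have to be queued. -/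
def SafetyProblem.pending (P : SafetyProblem X) (B : MBP X) (A : Abstraction X) (N : ℕ)
    (Q : Trace X) (T : Set (POB X)) : Set (POB X) :=
  {p | P.IsObligation B A N p ∧ p ∉ T ∧ ¬ p.Blocked Q}

theorem SafetyProblem.finite_pending (hbad : P.bad.IsMonomial) (harr : P.EliminatesArrays B A)
    (N : ℕ) (Q : Trace X) (T : Set (POB X)) : (P.pending B A N Q T).Finite :=
  (IsObligation.finite N hbad harr).subset fun _ hp => hp.1

theorem QueueInv.finite (hq : QueueInv P B A N queue) (hbad : P.bad.IsMonomial)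
    (harr : P.EliminatesArrays B A) : queue.Finite :=
  (SafetyProblem.IsObligation.finite N hbad harr).subset fun p hp => (hq p hp).1

theorem SafetyProblem.ncard_pending_add_le (hbad : P.bad.IsMonomial)
    (harr : P.EliminatesArrays B A) {l : FrameLemma X} (hl : l.Blocks p) (N : ℕ) (Q : Trace X)
    (T : Set (POB X)) :
    (P.pending B A N (Q.add p.level l) T).ncard ≤ (P.pending B A N Q (insert p T)).ncard := by
  refine Set.ncard_le_ncard (fun q hq => ⟨hq.1, ?_, fun hblocked => hq.2.2 ?_⟩)
    (finite_pending hbad harr _ _ _)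
  · rintro (rfl | hqT)
    · exact hq.2.2 (hl.blocked_add Q)
    · exact hq.2.1 hqT
  · exact hblocked.mono (Q.subset_add _ _)

theorem SafetyProblem.IsObligation.not_blocked_predecessor (hp : P.IsObligation B A N p)
    (hbad : P.bad.IsMonomial) (harr : P.EliminatesArrays B A) {i : ℕ} {M : Struct X}
    (h : S.call ((qi (Q i)).and (P.preFormula p.body)) (.sat M)) :
    ¬ (P.predecessor B A p.body M i).Blocked Q := fun hblocked => by
  obtain ⟨e, hqi, -⟩ := S.sat_sound _ _ h
  have hM := S.models_preFormula (hp.isCube hbad harr).qf h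
  exact hblocked M e hqi (hp.models_predecessor hbad harr hM i e)

theorem SafetyProblem.IsObligation.predecessor_mem_pending (hp : P.IsObligation B A N p)
    (hbad : P.bad.IsMonomial) (harr : P.EliminatesArrays B A) (htop : IsTop queue p) {i : ℕ}
    (hi : p.level = i + 1) {M : Struct X}
    (h : S.call ((qi (Q i)).and (P.preFormula p.body)) (.sat M)) :
    P.predecessor B A p.body M i ∈ P.pending B A N Q queue := by
  refine ⟨hp.predecessor hi (S.models_preFormula (hp.isCube hbad harr).qf h), fun hmem => ?_,
    hp.not_blocked_predecessor hbad harr h⟩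
  have hle : p.level ≤ i := htop.2 _ hmem
  omega

theorem SafetyProblem.ncard_pending_insert_lt (hbad : P.bad.IsMonomial)
    (harr : P.EliminatesArrays B A) {T : Set (POB X)} (hp : p ∈ P.pending B A N Q T) :
    (P.pending B A N Q (insert p T)).ncard < (P.pending B A N Q T).ncard := by
  have hsub : P.pending B A N Q (insert p T) ⊆ P.pending B A N Q T :=
    fun q hq => ⟨hq.1, fun hqT => hq.2.1 (.inr hqT), hq.2.2⟩
  exact Set.ncard_lt_ncard ⟨hsub, fun h => (h hp).2.1 (.inl rfl)⟩ (finite_pending hbad harr N Q T)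

/-- The rank of a configuration, which decreases as long as the level is not raised. In the
blocking phase it starts with twice the number of pending obligations plus the length of the
queue. -/
noncomputable def Config.rank (P : SafetyProblem X) (B : MBP X) (A : Abstraction X)
    (c : Config X) : ℕ ×ₗ ℕ ×ₗ ℕ :=
  match c.ctrl with
  | .start => toLex (4, toLex (0, 0))
  | .makeSafe queue =>
    toLex (3, toLex (2 * (P.pending B A c.N c.trace queue).ncard + queue.ncard, 0))
  | .qgen queue p _ cands =>
    toLex (3, toLex (2 * (P.pending B A c.N c.trace (insert p queue)).ncard + queue.ncard,
      cands.length + 1))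
  | .push i => toLex (2, toLex (2 * (c.N - i) + 1, 0))
  | .pushing i _ cands => toLex (2, toLex (2 * (c.N - i), cands.length))
  | .loop => toLex (1, toLex (0, 0))
  | .ret _ | .hang => toLex (0, toLex (0, 0))

theorem toLex_lt_toLex_iff {a b c a' b' c' : ℕ} :
    (toLex (a, toLex (b, c)) : ℕ ×ₗ ℕ ×ₗ ℕ) < toLex (a', toLex (b', c')) ↔
      a < a' ∨ a = a' ∧ (b < b' ∨ b = b' ∧ c < c') := by
  simp only [Prod.Lex.toLex_lt_toLex]

theorem QueueInv.rank_insert_predecessor_lt (hq : QueueInv P B A N queue)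
    (hbad : P.bad.IsMonomial) (harr : P.EliminatesArrays B A) (htop : IsTop queue p) {i : ℕ}
    (hi : p.level = i + 1) {M : Struct X}
    (h : S.call ((qi (Q i)).and (P.preFormula p.body)) (.sat M)) :
    Config.rank P B A ⟨N, Q, .makeSafe (insert (P.predecessor B A p.body M i) queue)⟩ <
      Config.rank P B A ⟨N, Q, .makeSafe queue⟩ := by
  have hmem := (hq p htop.1).1.predecessor_mem_pending hbad harr htop hi h
  have hpending := SafetyProblem.ncard_pending_insert_lt hbad harr hmem
  have hqueue := Set.ncard_insert_of_notMem hmem.2.1 (hq.finite hbad harr)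
  refine toLex_lt_toLex_iff.2 (.inr ⟨rfl, .inl ?_⟩)
  simp only
  omega

theorem QueueInv.rank_remove_lt (hq : QueueInv P B A N queue) (hbad : P.bad.IsMonomial)
    (harr : P.EliminatesArrays B A) (hp : p ∈ queue) (Q : Trace X) (ℓ : Formula X)
    (cands : List (FrameLemma X)) :
    Config.rank P B A ⟨N, Q, .qgen (queue \ {p}) p ℓ cands⟩ <
      Config.rank P B A ⟨N, Q, .makeSafe queue⟩ := by
  have hqueue := Set.ncard_sdiff_singleton_lt_of_mem hp (hq.finite hbad harr)
  refine toLex_lt_toLex_iff.2 (.inr ⟨rfl, .inl ?_⟩)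
  simp only [Set.insert_sdiff_self_of_mem hp]
  omega

theorem FrameLemma.Blocks.rank_add_lt {l : FrameLemma X} (hl : l.Blocks p)
    (hbad : P.bad.IsMonomial) (harr : P.EliminatesArrays B A) (N : ℕ) (Q : Trace X)
    (queue : Set (POB X)) (ℓ : Formula X) (cands : List (FrameLemma X)) :
    Config.rank P B A ⟨N, Q.add p.level l, .makeSafe queue⟩ <
      Config.rank P B A ⟨N, Q, .qgen queue p ℓ cands⟩ := by
  have hpending := SafetyProblem.ncard_pending_add_le hbad harr hl N Q queue
  refine toLex_lt_toLex_iff.2 (.inr ⟨rfl, ?_⟩)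
  simp only
  omega

theorem Step.level_eq_succ_or_rank_lt {c c' : Config X} (hbad : P.bad.IsMonomial)
    (harr : P.EliminatesArrays B A) (hc : c.Inv P B A) (h : Step P S B I A c c') :
    c'.N = c.N + 1 ∨ c'.N = c.N ∧ c'.rank P B A < c.rank P B A := by
  obtain ⟨-, hctrl⟩ := hc
  cases h with
  | unfold => exact .inl rfl
  | hang => exact hctrl.elim
  | predecessor N Q queue p i M htop hi h =>
    exact .inr ⟨rfl, QueueInv.rank_insert_predecessor_lt hctrl hbad harr htop hi h⟩
  | block N Q queue p i cands htop =>
    exact .inr ⟨rfl, QueueInv.rank_remove_lt hctrl hbad harr htop.1 _ _ _⟩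
  | qgen_none => exact .inr ⟨rfl, hctrl.2.1.rank_add_lt hbad harr _ _ _ _ _⟩
  | qgen_ok N Q queue p ℓ c =>
    exact .inr ⟨rfl, (hctrl.2.2 c List.mem_cons_self).rank_add_lt hbad harr _ _ _ _ _⟩
  | pushing_nil N Q i =>
    have hi : i < N := hctrl
    exact .inr ⟨rfl, toLex_lt_toLex_iff.2 (.inr ⟨rfl, .inl (by simp only; omega)⟩)⟩
  | _ => exact .inr ⟨rfl, toLex_lt_toLex_iff.2 (by simp)⟩

theorem exists_isTop (hne : queue.Nonempty) : ∃ p, IsTop queue p :=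
  let ⟨p, hp, hmin⟩ := (measure (POB.level (X := X))).wf.has_min queue hne
  ⟨p, hp, fun q hq => not_lt.1 (hmin q hq)⟩

section ExistsStep

variable (P : SafetyProblem X) (S : Solver X) (B : MBP X) (I : Interpolation X)
  (A : Abstraction X) (N : ℕ) (Q : Trace X)

theorem exists_step_makeSafe (queue : Set (POB X)) :
    ∃ c, Step P S B I A ⟨N, Q, .makeSafe queue⟩ c := by
  rcases queue.eq_empty_or_nonempty with rfl | hne
  · exact ⟨_, .blocked _ _⟩
  obtain ⟨p, hp⟩ := exists_isTop hne
  cases hlevel : p.level with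
  | zero => exact ⟨_, .cex _ _ _ p hp hlevel⟩
  | succ i =>
    obtain ⟨M | _ | _, ho⟩ := S.exists_outcome ((qi (Q i)).and (P.preFormula p.body))
    · exact ⟨_, .predecessor _ _ _ p i M hp hlevel ho⟩
    · exact ⟨_, .block _ _ _ p i [] hp hlevel ho (List.forall_mem_nil _)⟩
    · exact ⟨_, .block_hang _ _ _ p i hp hlevel ho⟩

theorem exists_step_qgen (queue : Set (POB X)) (p : POB X) (ℓ : Formula X)
    (cands : List (FrameLemma X)) : ∃ c, Step P S B I A ⟨N, Q, .qgen queue p ℓ cands⟩ c := by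
  rcases cands with _ | ⟨c, cs⟩
  · exact ⟨_, .qgen_none _ _ _ _ _⟩
  obtain ⟨M | _ | _, ho⟩ :=
    S.exists_outcome ((P.fwd (qi (Q (p.level - 1)))).and c.body.prime.not)
  · exact ⟨_, .qgen_fail _ _ _ _ _ _ _ M ho⟩
  · exact ⟨_, .qgen_ok _ _ _ _ _ _ _ ho⟩
  · exact ⟨_, .qgen_hang _ _ _ _ _ _ _ ho⟩

theorem exists_step_push (i : ℕ) : ∃ c, Step P S B I A ⟨N, Q, .push i⟩ c := by
  rcases lt_or_ge i N with hi | hi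
  · exact ⟨_, .push_frame _ _ _ [] [] hi⟩
  · by_cases hsafe : SafeCond N Q
    · exact ⟨_, .push_safe _ _ _ hi hsafe⟩
    · exact ⟨_, .push_done _ _ _ hi hsafe⟩

theorem exists_step_pushing (i : ℕ) (ρs : List (Subst X)) (cands : List (FrameLemma X)) :
    ∃ c, Step P S B I A ⟨N, Q, .pushing i ρs cands⟩ c := by
  rcases cands with _ | ⟨c, cs⟩
  · exact ⟨_, .pushing_nil _ _ _ _⟩
  by_cases hp : Pushable (Q i) (Q (i + 1)) c
  · obtain ⟨M | _ | _, hinit⟩ := S.exists_outcome (P.init.and c.body.not)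
    · exact ⟨_, .pushing_init_fail _ _ _ _ _ _ M hp hinit⟩
    · obtain ⟨M | _ | _, hquery⟩ := S.exists_outcome (P.pushQuery (Q i) ρs c.body)
      · exact ⟨_, .pushing_fail _ _ _ _ _ _ M hp hinit hquery⟩
      · exact ⟨_, .pushing_ok _ _ _ _ _ _ hp hinit hquery⟩
      · exact ⟨_, .pushing_hang _ _ _ _ _ _ hp hinit hquery⟩
    · exact ⟨_, .pushing_init_hang _ _ _ _ _ _ hp hinit⟩
  · exact ⟨_, .pushing_skip _ _ _ _ _ _ hp⟩

theorem exists_step {c : Config X} (h : ∀ r, c.ctrl ≠ .ret r) : ∃ c', Step P S B I A c c' := by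
  obtain ⟨N, Q, ctrl⟩ := c
  cases ctrl with
  | start =>
    obtain ⟨M | _ | _, ho⟩ := S.exists_outcome (P.init.and P.bad)
    · exact ⟨_, .start_sat _ _ M ho⟩
    · exact ⟨_, .start_unsat _ _ ho⟩
    · exact ⟨_, .start_hang _ _ ho⟩
  | loop => exact ⟨_, .unfold _ _⟩
  | makeSafe queue => exact exists_step_makeSafe P S B I A N Q queue
  | qgen queue p ℓ cands => exact exists_step_qgen P S B I A N Q queue p ℓ cands
  | push i => exact exists_step_push P S B I A N Q i
  | pushing i ρs cands => exact exists_step_pushing P S B I A N Q i ρs cands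
  | ret r => exact absurd rfl (h r)
  | hang => exact ⟨_, .hang _ _⟩

end ExistsStep

theorem IsRun.inv {run : ℕ → Config X} (hrun : IsRun P S B I A run) (hbad : P.bad.IsMonomial)
    (harr : P.EliminatesArrays B A) (n : ℕ) : (run n).Inv P B A := by
  induction n with
  | zero => exact hrun.1 ▸ P.inv_initial B A
  | succ n ih =>
    rcases hrun.2 n with hstep | ⟨-, heq⟩
    · exact hstep.inv hbad harr ih
    · exact heq ▸ ih

theorem IsRun.exists_ret_or_level_eq_succ {run : ℕ → Config X} (hrun : IsRun P S B I A run)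
    (hbad : P.bad.IsMonomial) (harr : P.EliminatesArrays B A) (n : ℕ) :
    ∃ m, (∃ r, (run m).ctrl = .ret r) ∨ (run m).N = (run n).N + 1 := by
  induction hrank : (run n).rank P B A using WellFoundedLT.induction generalizing n with
  | ind rank ih =>
    by_cases hret : ∃ r, (run n).ctrl = .ret r
    · exact ⟨n, .inl hret⟩
    have hstep := (hrun.2 n).resolve_right fun h => h.1 (exists_step P S B I A (not_exists.1 hret))
    rcases hstep.level_eq_succ_or_rank_lt hbad harr (hrun.inv hbad harr n) with hN | ⟨hN, hlt⟩
    · exact ⟨n + 1, .inr hN⟩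
    · exact hN ▸ ih _ (hrank ▸ hlt) (n + 1) rfl

theorem IsRun.exists_ret_or_level_eq {run : ℕ → Config X} (hrun : IsRun P S B I A run)
    (hbad : P.bad.IsMonomial) (harr : P.EliminatesArrays B A) (k : ℕ) :
    ∃ n, (∃ r, (run n).ctrl = .ret r) ∨ (run n).N = k := by
  induction k with
  | zero => exact ⟨0, .inr (hrun.1 ▸ rfl)⟩
  | succ k ih =>
    obtain ⟨n, hret | rfl⟩ := ih
    · exact ⟨n, .inl hret⟩
    · exact hrun.exists_ret_or_level_eq_succ hbad harr n

end Run

end Quic3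

theorem mainTheorem2 {X : Quic3.Srt → Type*} (P : Quic3.SafetyProblem X)
    (hbad : P.bad.IsMonomial)
    (S : Quic3.Solver X) (B : Quic3.MBP X) (I : Quic3.Interpolation X) (A : Quic3.Abstraction X)
    (harr : P.EliminatesArrays B A)
    (run : ℕ → Quic3.Config X) (hrun : Quic3.IsRun P S B I A run) (k : ℕ) :
    ∃ n, (run n).N = k ∨
      (run n).ctrl = Quic3.Control.ret Quic3.Result.safe ∨
      ((run n).ctrl = Quic3.Control.ret Quic3.Result.cex ∧
        P.HasCounterexample (run n).N) := by
  obtain ⟨n, ⟨_ | _, hret⟩ | hN⟩ := hrun.exists_ret_or_level_eq hbad harr k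
  · exact ⟨n, .inr (.inl hret)⟩
  · have hcex := (hrun.inv hbad harr n).ctrl
    rw [hret] at hcex
    exact ⟨n, .inr (.inr ⟨hret, hcex⟩)⟩
  · exact ⟨n, .inl hN⟩
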